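/- Theorem. A segment is given by its two distinct endpoints in $\mathbb{R}^2$ (it may be horizontal or vertical, and different segments may share endpoints or coordinates). A 3-rectangle is a closed region $[a,b]\times(-\infty,c]$ with $a\le b$, i.e. a (possibly degenerate) axis-parallel rectangle without lower side ("bottomless rectangle"). A region stabs a family $S$ of segments if it contains exactly one endpoint of each segment of $S$. Two regions are combinatorially equivalent if they contain the same endpoints of segments of $S$, and combinatorially different otherwise. A stabbing 3-rectangle is represented by (the numbers of) three not necessarily distinct segment endpoints that lie in it, one on its left side, one on its right side and one on its top side. All combinatorially different stabbing 3-rectangles of a family $S$ of $n$ segments can be computed in $O(n\log n)$ time. That is, there is one random access machine program which, on the input of any $n\ge 1$ segments $S$ (the number $n$ and the real coordinates of the $2n$ endpoints), halts after at most $T(n)$ steps, where $T(n)=O(n\log n)$ as $n\to\infty$, and outputs a list of representations of stabbing 3-rectangles of $S$ that contains exactly one member of every combinatorial equivalence class of stabbing 3-rectangles of $S$. The machine model: programs are built from assignments, sequencing, conditionals and while loops, over finitely many zero-initialised arrays of natural numbers and finitely many zero-initialised arrays of real numbers, indexed by computed natural numbers. Constants, array accesses, the integer operations $+$, $-$ (truncated),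 $\cdot$ and $/$ (rounded down), comparisons and assignments cost one step each. Real numbers can only be copied and compared. Every natural number that the program stores must be less than $(n+1)^k$ for a constant $k$ (words of $O(\log n)$ bits). -/

import Mathlib

/-! ### A random access machine with real cells

A program owns finitely many named, zero-initialised infinite arrays of natural numbers and finitely
many named infinite arrays of real numbers (a scalar variable is a cell of an array).  Every
operation has unit cost.  Reals can only be copied and compared, and there is no conversion
between reals and integers.  The semantics carries a word bound `W`: a program that tries to store
a natural number `≥ W` is stuck. -/

namespace RealRAM

/-- The memory: `nat a i` is cell `i` of integer array `a`, and `real a i` is cell `i` of real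
array `a`. -/
structure Memory where
  nat : ℕ → ℕ → ℕ
  real : ℕ → ℕ → ℝ

/-- Integer expressions.  An array name is a constant of the program, an index is computed. -/
inductive NExp : Type where
  | const (c : ℕ)
  | read (a : ℕ) (i : NExp)
  | add (e f : NExp)
  | sub (e f : NExp)
  | mul (e f : NExp)
  | div (e f : NExp)

namespace NExp

/-- Value of an integer expression (`sub` is truncated, `div` rounds down, with `x / 0 = 0`). -/
def eval (m : Memory) : NExp → ℕ
  | const c => c
  | read a i => m.nat a (i.eval m)
  | add e f => e.eval m + f.eval m
  | sub e f => e.eval m - f.eval m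
  | mul e f => e.eval m * f.eval m
  | div e f => e.eval m / f.eval m

/-- Cost of evaluating an integer expression: one step per constant, access or operation. -/
def cost : NExp → ℕ
  | const _ => 1
  | read _ i => i.cost + 1
  | add e f => e.cost + f.cost + 1
  | sub e f => e.cost + f.cost + 1
  | mul e f => e.cost + f.cost + 1
  | div e f => e.cost + f.cost + 1

end NExp

/-- Tests. `realLE a i b j` compares cell `i` of real array `a` with cell `j` of real array `b`. -/
inductive Test : Type where
  | natLE (e f : NExp)
  | realLE (a : ℕ) (i : NExp) (b : ℕ) (j : NExp)
  | not (t : Test)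
  | and (t u : Test)

namespace Test

/-- Truth of a test. -/
def Holds (m : Memory) : Test → Prop
  | natLE e f => e.eval m ≤ f.eval m
  | realLE a i b j => m.real a (i.eval m) ≤ m.real b (j.eval m)
  | not t => ¬ t.Holds m
  | and t u => t.Holds m ∧ u.Holds m

/-- Cost of a test (both sides of a conjunction are always evaluated). -/
def cost : Test → ℕ
  | natLE e f => e.cost + f.cost + 1
  | realLE _ i _ j => i.cost + j.cost + 3
  | not t => t.cost + 1
  | and t u => t.cost + u.cost + 1

end Test

/-- Programs.  `store a i e` stores `e` in cell `i` of integer array `a`; `copy a i b j` copies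
cell `j` of real array `b` into cell `i` of real array `a`. -/
inductive Program : Type where
  | skip
  | store (a : ℕ) (i e : NExp)
  | copy (a : ℕ) (i : NExp) (b : ℕ) (j : NExp)
  | seq (c d : Program)
  | branch (t : Test) (c d : Program)
  | loop (t : Test) (c : Program)

/-- Overwrite one integer cell. -/
def Memory.setNat (m : Memory) (a i v : ℕ) : Memory where
  nat := Function.update m.nat a (Function.update (m.nat a) i v)
  real := m.real

/-- Overwrite one real cell. -/
def Memory.setReal (m : Memory) (a i : ℕ) (v : ℝ) : Memory where
  nat := m.nat
  real := Function.update m.real a (Function.update (m.real a) i v)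

/-- `Exec W c m m' t`: with word bound `W`, program `c` started in memory `m` halts in memory `m'`
after exactly `t` steps. -/
inductive Exec (W : ℕ) : Program → Memory → Memory → ℕ → Prop where
  | skip (m : Memory) : Exec W .skip m m 1
  | store (m : Memory) (a : ℕ) (i e : NExp) (h : e.eval m < W) :
      Exec W (.store a i e) m (m.setNat a (i.eval m) (e.eval m)) (i.cost + e.cost + 1)
  | copy (m : Memory) (a : ℕ) (i : NExp) (b : ℕ) (j : NExp) :
      Exec W (.copy a i b j) m (m.setReal a (i.eval m) (m.real b (j.eval m)))
        (i.cost + j.cost + 2)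
  | seq {c d : Program} {m₁ m₂ m₃ : Memory} {t u : ℕ}
      (hc : Exec W c m₁ m₂ t) (hd : Exec W d m₂ m₃ u) :
      Exec W (.seq c d) m₁ m₃ (t + u)
  | branchTrue {b : Test} {c d : Program} {m m' : Memory} {t : ℕ}
      (hb : b.Holds m) (hc : Exec W c m m' t) :
      Exec W (.branch b c d) m m' (b.cost + t + 1)
  | branchFalse {b : Test} {c d : Program} {m m' : Memory} {t : ℕ}
      (hb : ¬ b.Holds m) (hd : Exec W d m m' t) :
      Exec W (.branch b c d) m m' (b.cost + t + 1)
  | loopDone {b : Test} {c : Program} {m : Memory} (hb : ¬ b.Holds m) :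
      Exec W (.loop b c) m m (b.cost + 1)
  | loopStep {b : Test} {c : Program} {m₁ m₂ m₃ : Memory} {t u : ℕ}
      (hb : b.Holds m₁) (hc : Exec W c m₁ m₂ t) (hl : Exec W (.loop b c) m₂ m₃ u) :
      Exec W (.loop b c) m₁ m₃ (b.cost + t + u + 1)

end RealRAM

/-! ### Stabbing 3-rectangles -/

namespace Stabbing

/-- A segment of nonzero length in the plane, given by its two endpoints. -/
structure Segment where
  p : ℝ × ℝ
  q : ℝ × ℝ
  ne : p ≠ q

/-- The region `R` contains exactly one endpoint of each segment. -/
def Stabs {n : ℕ} (R : Set (ℝ × ℝ)) (S : Fin n → Segment) : Prop :=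
  ∀ i, ((S i).p ∈ R ∧ (S i).q ∉ R) ∨ ((S i).p ∉ R ∧ (S i).q ∈ R)

/-- The set of all endpoints of the segments. -/
def endpoints {n : ℕ} (S : Fin n → Segment) : Set (ℝ × ℝ) :=
  {z | ∃ i, z = (S i).p ∨ z = (S i).q}

/-- Two regions are combinatorially equivalent if they contain the same segment endpoints. -/
def CombEquiv {n : ℕ} (S : Fin n → Segment) (R R' : Set (ℝ × ℝ)) : Prop :=
  R ∩ endpoints S = R' ∩ endpoints S

/-- The closed bottomless rectangle with left side `x = a`, right side `x = b`, top side `y = c`. -/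
def bottomless (a b c : ℝ) : Set (ℝ × ℝ) :=
  {z | a ≤ z.1 ∧ z.1 ≤ b ∧ z.2 ≤ c}

/-- A 3-rectangle: a (possibly degenerate) closed axis-parallel rectangle without lower side. -/
def IsThreeRectangle (R : Set (ℝ × ℝ)) : Prop :=
  ∃ a b c : ℝ, a ≤ b ∧ R = bottomless a b c

/-- The endpoints numbered `0, …, 2n - 1`: segment `i` has endpoints number `2i` and `2i + 1`. -/
def endpt {n : ℕ} (S : Fin n → Segment) (e : Fin (2 * n)) : ℝ × ℝ :=
  if e.val % 2 = 0 then (S ⟨e.val / 2, by omega⟩).p else (S ⟨e.val / 2, by omega⟩).q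

/-- The description of a 3-rectangle by (the numbers of) one endpoint on each of its sides. -/
structure Description (n : ℕ) where
  left : Fin (2 * n)
  right : Fin (2 * n)
  top : Fin (2 * n)

/-- The 3-rectangle given by a description. -/
def Description.region {n : ℕ} (S : Fin n → Segment) (d : Description n) : Set (ℝ × ℝ) :=
  bottomless (endpt S d.left).1 (endpt S d.right).1 (endpt S d.top).2

/-- The describing endpoints belong to the described region (hence lie on its boundary). -/
def Description.Valid {n : ℕ} (S : Fin n → Segment) (d : Description n) : Prop :=
  endpt S d.left ∈ d.region S ∧ endpt S d.right ∈ d.region S ∧ endpt S d.top ∈ d.region S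

/-- `L` lists all combinatorially different stabbing 3-rectangles of `S`, each exactly once up to
combinatorial equivalence. -/
structure ListsAllStabbers {n : ℕ} (S : Fin n → Segment) (L : List (Description n)) : Prop where
  valid : ∀ d ∈ L, d.Valid S
  stabs : ∀ d ∈ L, Stabs (d.region S) S
  different : L.Pairwise fun d d' => ¬ CombEquiv S (d.region S) (d'.region S)
  complete : ∀ R, IsThreeRectangle R → Stabs R S → ∃ d ∈ L, CombEquiv S R (d.region S)

/-- The initial memory on input `S`: integer array `0` holds `n` in cell `0`, real arrays `0` and
`1` hold the `x`- and `y`-coordinates of the `2n` endpoints, all other cells are zero. -/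
noncomputable def initialMemory {n : ℕ} (S : Fin n → Segment) : RealRAM.Memory where
  nat := fun a i => if a = 0 ∧ i = 0 then n else 0
  real := fun a i =>
    if h : i < 2 * n then
      if a = 0 then (endpt S ⟨i, h⟩).1 else if a = 1 then (endpt S ⟨i, h⟩).2 else 0
    else 0

/-- The memory `m` holds the output `L`: the length of `L` is in cell `0` of integer array `0`, and
integer arrays `1`, `2`, `3` hold the left, right and top endpoint numbers of its members. -/
def Outputs {n : ℕ} (m : RealRAM.Memory) (L : List (Description n)) : Prop :=
  m.nat 0 0 = L.length ∧
    ∀ (j : ℕ) (hj : j < L.length),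
      m.nat 1 j = (L[j].left : ℕ) ∧ m.nat 2 j = (L[j].right : ℕ) ∧ m.nat 3 j = (L[j].top : ℕ)

end Stabbing

/-! ### Program logic for the machine: framing, weakest preconditions, loop rules with time bounds.
-/

namespace RealRAM

/-! Rank the `2n` endpoints lexicographically, once by `(x, y)` and once by `(y, x)`, so that all
ranks are distinct. A stabbing 3-rectangle can be shrunk, without changing its content, until its
sides pass through extreme points of that content. In ranks it becomes a triple `(a, b, c)` of left,
right and top side, and this triple is determined by the content (`exists_rankStabber`,
`RankStabber.eq_of_inside_iff`).

Fix the left side `a`. Each segment has an endpoint inside, and the mate (other endpoint) of every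
point left of `a` is inside; these two facts give a lower bound `topOf` for `c`. Conversely, the
mate of the point on the top side is outside. If it lies left of `a` or above `c`, then `c` equals
this bound; if it lies to the right of `b`, then `c` equals the same bound in the reflected
configuration, whose left side comes from `b` (`RankStabber.top_eq`). Once `c = topOf` of `a`, the
same reasoning applied to the point on the right side determines `b` (`RankStabber.right_eq`). Hence
there is at most one candidate for each left side and, after reflection, one for each right side: at
most `4n` rectangles in all.

The bounds defining a candidate, together with the condition that no segment lies entirely to the
left of `a`, force each segment to have an endpoint inside. Such a candidate is therefore stabbing
exactly when it contains `n` endpoints (`stabs_of_card`, `accepts_iff`). The bounds are prefix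
maxima and cost linear time. The count is maintained while `a` sweeps from left to right: the top
only rises, and the goal for the right side is the maximum of a nondecreasing and a nonincreasing
function of `a`, so all sides together travel a linear distance (`sweepMeasure`,
`SweepState.left_succ`). Only the two merge sorts cost more than linear time.

A box in rank space and the closed rectangle in the plane through the same points have the same
content unless a tied point was left out. Thanks to the lexicographic order, one neighbour per side
decides this (`noTies_iff`). A rectangle found from the right is dropped if its top is also `topOf`
of its left side, since then it was found from the left too (`nodup_reported`,
`mem_flatMap_reported`).

For the machine, loop-free code is handled by weakest preconditions with a syntactic worst-case
time, and loops by an invariant with a decreasing measure. The program never writes reals: it sorts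
point numbers, so every comparison still refers to the input. -/

theorem Memory.nat_setNat (m : Memory) (a i v b j : ℕ) :
    (m.setNat a i v).nat b j = if b = a ∧ j = i then v else m.nat b j := by
  unfold Memory.setNat
  by_cases hb : b = a
  · subst hb
    by_cases hj : j = i <;> simp [hj]
  · simp [hb]

@[simp] theorem Memory.nat_setNat_self (m : Memory) (a i v : ℕ) :
    (m.setNat a i v).nat a = Function.update (m.nat a) i v := by
  simp [Memory.setNat]

@[simp] theorem Memory.nat_setNat_of_ne (m : Memory) (a i v b : ℕ) (h : b ≠ a) :
    (m.setNat a i v).nat b = m.nat b := by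
  simp [Memory.setNat, h]

namespace Program

/-- Worst-case cost of a loop-free program. -/
def time : Program → ℕ
  | skip => 1
  | store _ i e => i.cost + e.cost + 1
  | copy _ i _ j => i.cost + j.cost + 2
  | seq c d => c.time + d.time
  | branch t c d => t.cost + max c.time d.time + 1
  | loop _ _ => 0

/-- The integer arrays a program may write to. -/
def writes : Program → List ℕ
  | skip => []
  | store a _ _ => [a]
  | copy _ _ _ _ => []
  | seq c d => c.writes ++ d.writes
  | branch _ c d => c.writes ++ d.writes
  | loop _ c => c.writes

/-- A program that never writes to real arrays. -/
def NatOnly : Program → Prop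
  | skip => True
  | store _ _ _ => True
  | copy _ _ _ _ => False
  | seq c d => c.NatOnly ∧ d.NatOnly
  | branch _ c d => c.NatOnly ∧ d.NatOnly
  | loop _ c => c.NatOnly

/-- Weakest precondition of a loop-free program that does not write to real arrays. -/
def wp (W : ℕ) : Program → (Memory → Prop) → Memory → Prop
  | skip, Q, m => Q m
  | store a i e, Q, m => e.eval m < W ∧ Q (m.setNat a (i.eval m) (e.eval m))
  | copy _ _ _ _, _, _ => False
  | seq c d, Q, m => c.wp W (d.wp W Q) m
  | branch t c d, Q, m => (t.Holds m → c.wp W Q m) ∧ (¬ t.Holds m → d.wp W Q m)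
  | loop _ _, _, _ => False

end Program

/-- `m'` agrees with `m` on the real arrays and on all integer arrays outside the list `l`. -/
def Frame (l : List ℕ) (m m' : Memory) : Prop :=
  m'.real = m.real ∧ ∀ a, a ∉ l → m'.nat a = m.nat a

theorem Frame.refl (l : List ℕ) (m : Memory) : Frame l m m := ⟨rfl, fun _ _ => rfl⟩

theorem Frame.trans {l : List ℕ} {m₁ m₂ m₃ : Memory} (h : Frame l m₁ m₂) (h' : Frame l m₂ m₃) :
    Frame l m₁ m₃ :=
  ⟨h'.1.trans h.1, fun a ha => (h'.2 a ha).trans (h.2 a ha)⟩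

theorem Frame.mono {l l' : List ℕ} {m m' : Memory} (h : Frame l m m') (hl : l ⊆ l') :
    Frame l' m m' :=
  ⟨h.1, fun a ha => h.2 a fun h' => ha (hl h')⟩

theorem Frame.setNat {l : List ℕ} {a : ℕ} (m : Memory) (i v : ℕ) (ha : a ∈ l) :
    Frame l m (m.setNat a i v) := by
  refine ⟨rfl, fun b hb => ?_⟩
  have : b ≠ a := fun h => hb (h ▸ ha)
  simp [Memory.setNat, this]

theorem Exec.frame {W : ℕ} {c : Program} {m m' : Memory} {t : ℕ} (h : Exec W c m m' t)
    (hc : c.NatOnly) : Frame c.writes m m' := by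
  induction h with
  | skip m => exact Frame.refl _ _
  | store m a i e _ => exact Frame.setNat _ _ _ (by simp [Program.writes])
  | copy => exact hc.elim
  | seq _ _ ih₁ ih₂ =>
    exact ((ih₁ hc.1).mono (by simp [Program.writes])).trans
      ((ih₂ hc.2).mono (by simp [Program.writes]))
  | branchTrue _ _ ih => exact (ih hc.1).mono (by simp [Program.writes])
  | branchFalse _ _ ih => exact (ih hc.2).mono (by simp [Program.writes])
  | loopDone => exact Frame.refl _ _
  | loopStep _ _ _ ih₁ ih₂ => exact Frame.trans (ih₁ hc) (ih₂ hc)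

/-- With word bound `W`, the program `c` started in `m` halts within `T` steps in a memory that
satisfies `Q` and differs from `m` only in the integer arrays that `c` writes to. -/
def Runs (W : ℕ) (c : Program) (m : Memory) (T : ℕ) (Q : Memory → Prop) : Prop :=
  ∃ m' t, Exec W c m m' t ∧ t ≤ T ∧ Frame c.writes m m' ∧ Q m'

variable {W : ℕ}

theorem Runs.mono {c : Program} {m : Memory} {T T' : ℕ} {Q Q' : Memory → Prop}
    (h : Runs W c m T Q) (hT : T ≤ T') (hQ : ∀ m', Frame c.writes m m' → Q m' → Q' m') :
    Runs W c m T' Q' := by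
  obtain ⟨m', t, he, ht, hf, hq⟩ := h
  exact ⟨m', t, he, ht.trans hT, hf, hQ m' hf hq⟩

theorem Runs.seq {c d : Program} {m : Memory} {T U V : ℕ} {Q R : Memory → Prop}
    (h : Runs W c m T Q) (h' : ∀ m', Frame c.writes m m' → Q m' → Runs W d m' U R)
    (hV : T + U ≤ V) :
    Runs W (.seq c d) m V R := by
  obtain ⟨m₁, t, he, ht, hf, hq⟩ := h
  obtain ⟨m₂, u, he', hu, hf', hr⟩ := h' m₁ hf hq
  exact ⟨m₂, t + u, .seq he he', by omega, (hf.mono (by simp [Program.writes])).trans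
    (hf'.mono (by simp [Program.writes])), hr⟩

/-- `time` takes the maximum over the arms of a branch, so one syntactic number bounds all
executions. Loops and real copies have precondition `False`. -/
theorem Program.wp_sound {c : Program} {m : Memory} {Q : Memory → Prop} (h : c.wp W Q m) :
    ∃ m' t, Exec W c m m' t ∧ t ≤ c.time ∧ Q m' := by
  induction c generalizing m Q with
  | skip => exact ⟨m, 1, .skip m, le_rfl, h⟩
  | store a i e => exact ⟨_, _, .store m a i e h.1, le_rfl, h.2⟩
  | copy => exact h.elim
  | seq c d ihc ihd =>
    obtain ⟨m₁, t, he, ht, hq⟩ := ihc h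
    obtain ⟨m₂, u, he', hu, hr⟩ := ihd hq
    exact ⟨m₂, t + u, .seq he he', Nat.add_le_add ht hu, hr⟩
  | branch b c d ihc ihd =>
    by_cases hb : b.Holds m
    · obtain ⟨m₁, t, he, ht, hq⟩ := ihc (h.1 hb)
      exact ⟨m₁, _, .branchTrue hb he, by simp only [Program.time]; omega, hq⟩
    · obtain ⟨m₁, t, he, ht, hq⟩ := ihd (h.2 hb)
      exact ⟨m₁, _, .branchFalse hb he, by simp only [Program.time]; omega, hq⟩
  | loop => exact h.elim

theorem Runs.of_wp {c : Program} {m : Memory} {T : ℕ} {Q : Memory → Prop} (hc : c.NatOnly)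
    (hT : c.time ≤ T) (h : c.wp W Q m) : Runs W c m T Q := by
  obtain ⟨m', t, he, ht, hq⟩ := Program.wp_sound h
  exact ⟨m', t, he, ht.trans hT, he.frame hc, hq⟩

/-- A loop with an invariant and a strictly decreasing measure. -/
theorem Runs.loop {b : Test} {c : Program} {m : Memory} {T U : ℕ} (I : Memory → Prop)
    (μ : Memory → ℕ) (h₀ : I m)
    (hstep : ∀ m', Frame c.writes m m' → I m' → b.Holds m' →
      Runs W c m' T fun m'' => I m'' ∧ μ m'' < μ m')
    (hU : μ m * (T + b.cost + 1) + b.cost + 1 ≤ U) :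
    Runs W (.loop b c) m U fun m' => I m' ∧ ¬ b.Holds m' := by
  suffices H : ∀ k m', μ m' = k → Frame c.writes m m' → I m' →
      ∃ m'' t, Exec W (.loop b c) m' m'' t ∧ t ≤ k * (T + b.cost + 1) + b.cost + 1 ∧
        Frame c.writes m m'' ∧ I m'' ∧ ¬ b.Holds m'' by
    obtain ⟨m', t, he, ht, hf, hI⟩ := H _ m rfl (Frame.refl _ _) h₀
    exact ⟨m', t, he, ht.trans hU, hf, hI⟩
  intro k
  induction k using Nat.strong_induction_on with
  | _ k ih =>
    intro m' hk hf hI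
    by_cases hb : b.Holds m'
    · obtain ⟨m₁, t, he, ht, hf', hI', hμ⟩ := hstep m' hf hI hb
      rw [hk] at hμ
      obtain ⟨m₂, u, he', hu, hf'', hI''⟩ := ih _ hμ m₁ rfl (hf.trans hf') hI'
      refine ⟨m₂, _, .loopStep hb he he', ?_, hf'', hI''⟩
      -- A round costs at most `T + b.cost + 1`, and the measure drops by at least one to pay for
      -- it.
      have := Nat.mul_le_mul_right (T + b.cost + 1) (Nat.succ_le_of_lt hμ)
      rw [Nat.succ_mul] at this
      omega
    · exact ⟨m', _, .loopDone hb, by omega, hf, hI, hb⟩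

/-- The scalar variable stored in cell `0` of integer array `a`. -/
abbrev var (a : ℕ) : NExp := .read a (.const 0)

/-- Assignment to the scalar variable stored in cell `0` of integer array `a`. -/
abbrev assign (a : ℕ) (e : NExp) : Program := .store a (.const 0) e

/-- The test `e < f`. -/
abbrev ltTest (e f : NExp) : Test := .natLE (.add e (.const 1)) f

/-- Run `c` with the variable `k` taking the values `0, 1, …` below the value of the variable
`b`. -/
def forLoop (k b : ℕ) (c : Program) : Program :=
  .seq (assign k (.const 0))
    (.loop (ltTest (var k) (var b)) (.seq c (assign k (.add (var k) (.const 1)))))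

/-- Test, increment and loop step cost 7 + 6 + 1, hence `T + 14` per round; the 11 is the initial
assignment (3) plus the final failing test (8). The invariant is demanded after the increment,
because the counter is part of the memory. -/
theorem Runs.forLoop {k b : ℕ} {c : Program} {m : Memory} {T U N : ℕ} (I : ℕ → Memory → Prop)
    (hk : k ∉ c.writes) (hb : b ∉ k :: c.writes) (hN : m.nat b 0 = N) (hW : N < W)
    (h₀ : I 0 (m.setNat k 0 0))
    (hstep : ∀ i m', i < N → Frame (k :: c.writes) m m' → m'.nat k 0 = i → I i m' →
      Runs W c m' T fun m'' => I (i + 1) (m''.setNat k 0 (i + 1)))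
    (hU : N * (T + 14) + 11 ≤ U) :
    Runs W (forLoop k b c) m U (I N) := by
  have hbk : b ≠ k := fun h => hb (by simp [h])
  have hsub : (Program.seq c (assign k (.add (var k) (.const 1)))).writes ⊆ k :: c.writes := by
    intro x; simp [Program.writes]; tauto
  have hinit : Runs W (assign k (.const 0)) m 3 fun m' => m' = m.setNat k 0 0 :=
    .of_wp trivial (by simp [Program.time, NExp.cost])
      (by simp [Program.wp, NExp.eval]; omega)
  refine Runs.seq (T := 3) (U := N * (T + 14) + 8) hinit ?_ (by omega)
  rintro m' - rfl
  set m₀ := m.setNat k 0 0 with hm₀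
  have hf₀ : Frame (k :: c.writes) m m₀ := Frame.setNat _ _ _ (by simp)
  refine (Runs.loop (T := T + 6) (U := N * (T + 14) + 8)
    (fun m' => ∃ i, i ≤ N ∧ m'.nat k 0 = i ∧ I i m') (fun m' => N - m'.nat k 0)
    ⟨0, Nat.zero_le _, by simp [hm₀], h₀⟩ ?_ ?_).mono le_rfl ?_
  · rintro m₁ hf ⟨i, hi, hki, hI⟩ hlt
    have hf₁ : Frame (k :: c.writes) m m₁ := hf₀.trans (hf.mono hsub)
    have hbN : m₁.nat b 0 = N := by rw [hf₁.2 b hb, hN]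
    have hiN : i < N := by
      simp [Test.Holds, NExp.eval, hki, hbN] at hlt; omega
    refine Runs.seq (hstep i m₁ hiN hf₁ hki hI) ?_ le_rfl
    intro m₂ hf₂ hI₂
    have hk₂ : m₂.nat k 0 = i := by rw [hf₂.2 k hk, hki]
    refine .of_wp trivial (by simp [Program.time, NExp.cost]) ?_
    simp only [Program.wp, NExp.eval, hk₂]
    refine ⟨by omega, ⟨i + 1, hiN, by simp, hI₂⟩, by simp [hki]; omega⟩
  · have : N - m₀.nat k 0 = N := by simp [hm₀]
    simp only [this, Test.cost, NExp.cost]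
    exact le_of_eq (by ring)
  · rintro m₁ hf ⟨⟨i, hi, hki, hI⟩, hlt⟩
    have hf₁ : Frame (k :: c.writes) m m₁ := hf₀.trans (hf.mono hsub)
    have hbN : m₁.nat b 0 = N := by rw [hf₁.2 b hb, hN]
    have : i = N := by
      simp [Test.Holds, NExp.eval, hki, hbN] at hlt; omega
    exact this ▸ hI

/-! ### Merging sorted blocks -/

/-- Every block `[t * w, t * w + w)` of `S`, cut off at `N`, is sorted. -/
def BlockSorted (le : ℕ → ℕ → Prop) (N w : ℕ) (S : ℕ → ℕ) : Prop :=
  ∀ t p q, t * w ≤ p → p ≤ q → q < t * w + w → q < N → le (S p) (S q)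

/-- The blocks of length `2 * w` of `S` before position `k` have been merged into `D`. -/
structure Merged (le : ℕ → ℕ → Prop) (N w : ℕ) (S D : ℕ → ℕ) (k : ℕ) : Prop where
  lt : ∀ p < k, D p < N
  sorted : BlockSorted le k (2 * w) D
  mem : ∀ p < k, ∃ q < k, D q = S p
  start : N ≤ k ∨ ∃ t, k = t * (2 * w)

/-- The blocks `[s, mid)` and `[mid, e)` of `S`, of which `[i, mid)` and `[j, e)` remain, are being
merged into `D`, which is filled up to position `k`. -/
structure Merging (le : ℕ → ℕ → Prop) (N w : ℕ) (S D : ℕ → ℕ) (t k i mid j e : ℕ) : Prop where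
  lt : ∀ p < k, D p < N
  sorted : BlockSorted le k (2 * w) D
  mem : ∀ p, p < i ∨ (mid ≤ p ∧ p < j) → ∃ q < k, D q = S p
  start_le : t * (2 * w) ≤ i
  le_mid : i ≤ mid
  mid_le : mid ≤ j
  le_end : j ≤ e
  mid_eq : mid = min (t * (2 * w) + w) N
  end_eq : e = min (t * (2 * w) + 2 * w) N
  add_eq : i + j = k + mid
  le : ∀ p < k, t * (2 * w) ≤ p → ∀ q, (i ≤ q ∧ q < mid) ∨ (j ≤ q ∧ q < e) → le (D p) (S q)

section Merge

variable {le : ℕ → ℕ → Prop} {N w : ℕ} {S D D' : ℕ → ℕ} {t k i mid j e : ℕ}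

/-- A position before `N` where a merge has ended is a multiple of `2 * w`, so a fresh pair of
blocks starts there. Nothing of that pair has been moved yet, so the comparison between moved and
remaining elements is vacuous. -/
theorem Merged.merging (h : Merged le N w S D k) (hk : k < N) :
    ∃ t, Merging le N w S D t k k (min (k + w) N) (min (k + w) N) (min (k + 2 * w) N) := by
  obtain h' | ⟨t, ht⟩ := h.start
  · omega
  · refine ⟨t, h.lt, h.sorted, ?_, ht.ge, by omega, le_rfl, by omega, by rw [← ht], by rw [← ht],
      rfl, fun p hp hp' => by omega⟩
    intro p hp
    exact h.mem p (by omega)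

theorem Merging.merged (h : Merging le N w S D t k i mid j e) (hk : e ≤ k) :
    Merged le N w S D k := by
  have h1 := h.le_mid
  have h2 := h.le_end
  have h3 := h.add_eq
  have h4 := h.end_eq
  refine ⟨h.lt, h.sorted, fun p hp => h.mem p (by omega), ?_⟩
  by_cases hN : N ≤ k
  · exact .inl hN
  · exact .inr ⟨t + 1, by rw [Nat.succ_mul]; omega⟩

theorem block_unique {t t' w p : ℕ} (h₁ : t * w ≤ p) (h₂ : p < t * w + w) (h₃ : t' * w ≤ p)
    (h₄ : p < t' * w + w) : t = t' := by
  rw [← Nat.succ_mul] at h₂ h₄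
  have h := Nat.lt_of_mul_lt_mul_right (h₁.trans_lt h₄)
  have h' := Nat.lt_of_mul_lt_mul_right (h₃.trans_lt h₂)
  omega

/-- A new last element concerns only the block that contains its position, and there it has to
dominate all earlier elements. -/
theorem blockSorted_succ (hrefl : ∀ a, le a a) (h : BlockSorted le k w D)
    (hD : ∀ p < k, D' p = D p) (hk : t * w ≤ k) (hk' : k < t * w + w)
    (hle : ∀ p < k, t * w ≤ p → le (D p) (D' k)) : BlockSorted le (k + 1) w D' := by
  intro t' p q hp hpq hq hqk
  obtain rfl | hqk' := Nat.eq_or_lt_of_le (Nat.le_of_lt_succ hqk)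
  · obtain rfl := block_unique hk hk' (hp.trans hpq) hq
    obtain rfl | hpq' := Nat.eq_or_lt_of_le hpq
    · exact hrefl _
    · rw [hD p hpq']; exact hle p hpq' hp
  · rw [hD p (by omega), hD q hqk']
    exact h t' p q hp hpq hq hqk'

/-- The moved head is least among all that remains: in its own block by sortedness, in the other one
by the comparison of heads and transitivity. -/
theorem Merging.left (hrefl : ∀ a, le a a) (htrans : ∀ a b c, le a b → le b c → le a c)
    (h : Merging le N w S D t k i mid j e) (hS : BlockSorted le N w S) (hSN : ∀ p < N, S p < N)
    (hi : i < mid) (hij : j < e → le (S i) (S j)) (hD : ∀ p < k, D' p = D p) (hk : D' k = S i) :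
    Merging le N w S D' t (k + 1) (i + 1) mid j e := by
  obtain ⟨h1, h2, h3, h4, h5, h6, h7, h8, h9, h10, h11⟩ := h
  -- The block `t` of length `2 * w` consists of the blocks `2 * t` and `2 * t + 1` of length `w`.
  have e1 : 2 * t * w = t * (2 * w) := by ring
  have e2 : (2 * t + 1) * w = t * (2 * w) + w := by ring
  refine ⟨?_, ?_, ?_, by omega, hi, h6, h7, h8, h9, by omega, ?_⟩
  · intro p hp
    obtain rfl | hp' := Nat.eq_or_lt_of_le (Nat.le_of_lt_succ hp)
    · rw [hk]; exact hSN _ (by omega)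
    · rw [hD p hp']; exact h1 p hp'
  · refine blockSorted_succ hrefl h2 hD (by omega) (t := t) (by omega) ?_
    intro p hp hp'
    rw [hk]
    exact h11 p hp hp' i (.inl ⟨le_rfl, hi⟩)
  · intro p hp
    by_cases hpi : p = i
    · exact ⟨k, by omega, by rw [hk, hpi]⟩
    · obtain ⟨q, hq, hq'⟩ := h3 p (by omega)
      exact ⟨q, by omega, by rw [hD q hq, hq']⟩
  · intro p hp hp' q hq
    obtain rfl | hp'' := Nat.eq_or_lt_of_le (Nat.le_of_lt_succ hp)
    · rw [hk]
      obtain hq | hq := hq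
      · exact hS (2 * t) i q (by omega) (by omega) (by omega) (by omega)
      · exact htrans _ _ _ (hij (by omega))
          (hS (2 * t + 1) j q (by omega) (by omega) (by omega) (by omega))
    · rw [hD p hp'']
      exact h11 p hp'' hp' q (by omega)

/-- Mirror image of `Merging.left`. -/
theorem Merging.right (hrefl : ∀ a, le a a) (htrans : ∀ a b c, le a b → le b c → le a c)
    (h : Merging le N w S D t k i mid j e) (hS : BlockSorted le N w S) (hSN : ∀ p < N, S p < N)
    (hj : j < e) (hij : i < mid → le (S j) (S i)) (hD : ∀ p < k, D' p = D p) (hk : D' k = S j) :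
    Merging le N w S D' t (k + 1) i mid (j + 1) e := by
  obtain ⟨h1, h2, h3, h4, h5, h6, h7, h8, h9, h10, h11⟩ := h
  have e1 : 2 * t * w = t * (2 * w) := by ring
  have e2 : (2 * t + 1) * w = t * (2 * w) + w := by ring
  refine ⟨?_, ?_, ?_, by omega, h5, by omega, hj, h8, h9, by omega, ?_⟩
  · intro p hp
    obtain rfl | hp' := Nat.eq_or_lt_of_le (Nat.le_of_lt_succ hp)
    · rw [hk]; exact hSN _ (by omega)
    · rw [hD p hp']; exact h1 p hp'
  · refine blockSorted_succ hrefl h2 hD (by omega) (t := t) (by omega) ?_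
    intro p hp hp'
    rw [hk]
    exact h11 p hp hp' j (.inr ⟨le_rfl, hj⟩)
  · intro p hp
    by_cases hpi : p = j
    · exact ⟨k, by omega, by rw [hk, hpi]⟩
    · obtain ⟨q, hq, hq'⟩ := h3 p (by omega)
      exact ⟨q, by omega, by rw [hD q hq, hq']⟩
  · intro p hp hp' q hq
    obtain rfl | hp'' := Nat.eq_or_lt_of_le (Nat.le_of_lt_succ hp)
    · rw [hk]
      obtain hq | hq := hq
      · exact htrans _ _ _ (hij (by omega))
          (hS (2 * t) i q (by omega) (by omega) (by omega) (by omega))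
      · exact hS (2 * t + 1) j q (by omega) (by omega) (by omega) (by omega)
    · rw [hD p hp'']
      exact h11 p hp'' hp' q (by omega)

end Merge

/-! ### Merge sort -/

notation "nSegments" => (4 : ℕ)
notation "nPoints" => (5 : ℕ)
notation "perm" => (6 : ℕ)
notation "permTmp" => (9 : ℕ)
notation "width" => (10 : ℕ)
notation "counter" => (11 : ℕ)
notation "leftPos" => (12 : ℕ)
notation "leftEnd" => (13 : ℕ)
notation "rightPos" => (14 : ℕ)
notation "rightEnd" => (15 : ℕ)

/-- Lexicographic comparison of the pairs `(u e, v e)` and `(u f, v f)`. -/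
def LexLE (u v : ℕ → ℝ) (e f : ℕ) : Prop :=
  u f ≤ u e → u e ≤ u f ∧ v e ≤ v f

theorem LexLE.refl (u v : ℕ → ℝ) (e : ℕ) : LexLE u v e e := fun _ => ⟨le_rfl, le_rfl⟩

theorem LexLE.trans {u v : ℕ → ℝ} {e f g : ℕ} (h : LexLE u v e f) (h' : LexLE u v f g) :
    LexLE u v e g := by
  intro hge
  have hfg : u g ≤ u f := by
    by_contra hlt
    have := (h (by linarith)).1
    linarith
  obtain ⟨h1, h2⟩ := h' hfg
  obtain ⟨h3, h4⟩ := h (by linarith)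
  exact ⟨by linarith, by linarith⟩

/-- Totality: a failed comparison licenses moving the other head. -/
theorem LexLE.of_not {u v : ℕ → ℝ} {e f : ℕ} (h : ¬ LexLE u v e f) : LexLE u v f e := by
  unfold LexLE at h ⊢
  push Not at h
  obtain ⟨h1, h2⟩ := h
  exact fun h3 => ⟨h1, (h2 h3).le⟩

theorem LexLE.le {u v : ℕ → ℝ} {e f : ℕ} (h : LexLE u v e f) : u e ≤ u f := by
  by_contra hlt
  have := (h (by linarith)).1
  linarith

/-- Lexicographic comparison of two cells of the pair of real arrays `a` and `b`. -/
def lexTest (a b : ℕ) (e f : NExp) : Test :=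
  .not (.and (.realLE a f a e) (.not (.and (.realLE a e a f) (.realLE b e b f))))

theorem lexTest_holds (a b : ℕ) (e f : NExp) (m : Memory) :
    (lexTest a b e f).Holds m ↔ LexLE (m.real a) (m.real b) (e.eval m) (f.eval m) := by
  simp [lexTest, Test.Holds, LexLE]

/-- The minimum of two expressions. -/
def minExp (e f : NExp) : NExp := .sub e (.sub e f)

@[simp] theorem minExp_eval (e f : NExp) (m : Memory) :
    (minExp e f).eval m = min (e.eval m) (f.eval m) := by
  simp only [minExp, NExp.eval]; omega

/-- Begin to merge the next two blocks if the previous merge is complete. -/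
def openBlocks : Program :=
  .branch (.natLE (var rightEnd) (var counter))
    (.seq (assign leftPos (var counter))
      (.seq (assign leftEnd (minExp (.add (var counter) (var width)) (var nPoints)))
        (.seq (assign rightPos (var leftEnd))
          (assign rightEnd
            (minExp (.add (var counter) (.mul (.const 2) (var width))) (var nPoints))))))
    .skip

/-- Move the smaller of the heads of the two blocks. -/
def moveHead (a b : ℕ) : Program :=
  .branch (.and (ltTest (var leftPos) (var leftEnd))
      (.not (.and (ltTest (var rightPos) (var rightEnd))
        (.not (lexTest a b (.read perm (var leftPos)) (.read perm (var rightPos)))))))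
    (.seq (.store permTmp (var counter) (.read perm (var leftPos)))
      (assign leftPos (.add (var leftPos) (.const 1))))
    (.seq (.store permTmp (var counter) (.read perm (var rightPos)))
      (assign rightPos (.add (var rightPos) (.const 1))))

/-- Merge the blocks of length `width` in pairs. -/
def mergePass (a b : ℕ) : Program :=
  .seq (assign rightEnd (.const 0)) (forLoop counter nPoints (.seq openBlocks (moveHead a b)))

/-- Copy `permTmp` back to `perm`. -/
def copyBack : Program :=
  forLoop counter nPoints (.store perm (var counter) (.read permTmp (var counter)))

/-- Bottom-up merge sort of the numbers below `nPoints`. -/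
def sortProgram (a b : ℕ) : Program :=
  .seq (forLoop counter nPoints (.store perm (var counter) (var counter)))
    (.seq (assign width (.const 1))
      (.loop (ltTest (var width) (var nPoints))
        (.seq (mergePass a b)
          (.seq copyBack (assign width (.mul (.const 2) (var width)))))))

/-- The arrays written by `openBlocks` and `moveHead`. -/
abbrev mergeWrites : List ℕ :=
  [leftPos, leftEnd, rightPos, rightEnd, permTmp, leftPos, permTmp, rightPos]

theorem runs_moveHead {W N w a b t k : ℕ} {S : ℕ → ℕ} {m : Memory} (hk : m.nat counter 0 = k)
    (hkN : k < N) (hW : 2 * N + 1 < W) (hm : m.nat perm = S)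
    (hS : BlockSorted (LexLE (m.real a) (m.real b)) N w S) (hSN : ∀ p < N, S p < N)
    (hke : k < m.nat rightEnd 0)
    (h : Merging (LexLE (m.real a) (m.real b)) N w S (m.nat permTmp) t k (m.nat leftPos 0)
      (m.nat leftEnd 0) (m.nat rightPos 0) (m.nat rightEnd 0)) :
    Runs W (moveHead a b) m 120 fun m' => m'.nat rightEnd = m.nat rightEnd ∧
      Merging (LexLE (m.real a) (m.real b)) N w S (m'.nat permTmp) t (k + 1) (m'.nat leftPos 0)
      (m'.nat leftEnd 0) (m'.nat rightPos 0) (m'.nat rightEnd 0) := by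
  have h1 := h.le_mid
  have h2 := h.mid_le
  have h3 := h.le_end
  have h4 := h.add_eq
  have h5 := h.end_eq
  have h6 := h.mid_eq
  refine .of_wp ⟨⟨trivial, trivial⟩, trivial, trivial⟩ (by
    simp [Program.time, NExp.cost, Test.cost, moveHead, lexTest]) ?_
  simp only [moveHead, Program.wp, Test.Holds, NExp.eval, lexTest_holds, hk, hm]
  constructor
  · rintro ⟨hi, hj⟩
    have key := h.left (D' := Function.update (m.nat permTmp) k (S (m.nat leftPos 0)))
      (LexLE.refl _ _) (fun _ _ _ => LexLE.trans) hS hSN hi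
      (fun hj' => by by_contra hle; exact hj ⟨hj', hle⟩)
      (fun p hp => by simp [Function.update_apply]; omega) (by simp)
    have hSi := hSN (m.nat leftPos 0) (by omega)
    refine ⟨by omega, by simp; omega, by simp, ?_⟩
    simpa using key
  · intro hij
    -- If the right block were exhausted, `i + j = k + mid` and `k < e` would leave the left block
    -- nonempty, and the test would have succeeded.
    have hj : m.nat rightPos 0 < m.nat rightEnd 0 := by
      by_contra hj
      apply hij
      constructor
      · omega
      · omega
    have key := h.right (D' := Function.update (m.nat permTmp) k (S (m.nat rightPos 0)))
      (LexLE.refl _ _) (fun _ _ _ => LexLE.trans) hS hSN hj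
      (fun hi => LexLE.of_not fun hle => hij ⟨hi, fun h => h.2 hle⟩)
      (fun p hp => by simp [Function.update_apply]; omega) (by simp)
    have hSj := hSN (m.nat rightPos 0) (by omega)
    refine ⟨by omega, by simp; omega, by simp, ?_⟩
    simpa using key

/-- One loop over output positions replaces nested loops over pairs of blocks: a new pair is opened
whenever the end of the previous one has been reached, so every position costs constant time.
Resetting `rightEnd` to 0 makes the first round open a pair. -/
theorem runs_mergePass {W N w a b : ℕ} {m : Memory} (hN : m.nat nPoints 0 = N)
    (hw : m.nat width 0 = w) (hw0 : 0 < w) (hW : 2 * N + 1 < W)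
    (hS : BlockSorted (LexLE (m.real a) (m.real b)) N w (m.nat perm))
    (hSN : ∀ p < N, m.nat perm p < N) :
    Runs W (mergePass a b) m (200 * N + 20) fun m' =>
      Merged (LexLE (m.real a) (m.real b)) N w (m.nat perm) (m'.nat permTmp) N := by
  refine Runs.seq (T := 3) (U := 200 * N + 11) (Q := fun m' => m' = m.setNat rightEnd 0 0)
    (.of_wp trivial (by simp [Program.time, NExp.cost])
      (by simp [Program.wp, NExp.eval]; omega)) ?_ (by omega)
  rintro m' - rfl
  set le := LexLE (m.real a) (m.real b) with hle
  set S := m.nat perm with hSdef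
  refine (Runs.forLoop (N := N) (T := 180) (fun k m' =>
    (m'.nat rightEnd 0 ≤ k ∧ Merged le N w S (m'.nat permTmp) k) ∨
    (k < m'.nat rightEnd 0 ∧ ∃ t, Merging le N w S (m'.nat permTmp) t k (m'.nat leftPos 0)
      (m'.nat leftEnd 0) (m'.nat rightPos 0) (m'.nat rightEnd 0)))
    -- The arrays written do not depend on `a` and `b`, but `decide` needs a closed list, so it is
    -- spelled out.
    (show _ ∉ mergeWrites by decide) (show _ ∉ counter :: mergeWrites by decide)
    (by simpa using hN) (by omega) ?_ ?_ (by omega)).mono le_rfl ?_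
  · refine .inl ⟨by simp, ?_, ?_, ?_, .inr ⟨0, by simp⟩⟩
    · intro p hp; omega
    · intro t p q _ _ _ h; omega
    · intro p hp; omega
  · intro k m' hk hf hkm hI
    have hN' : m'.nat nPoints 0 = N := by
      rw [hf.2 _ (show _ ∉ counter :: mergeWrites by decide)]; simpa using hN
    have hw' : m'.nat width 0 = w := by
      rw [hf.2 _ (show _ ∉ counter :: mergeWrites by decide)]; simpa using hw
    have hS' : m'.nat perm = S := by
      rw [hf.2 _ (show _ ∉ counter :: mergeWrites by decide)]; simp [hSdef]
    have hr : m'.real = m.real := by rw [hf.1]; rfl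
    refine Runs.seq (T := 60) (U := 120) (Q := fun m'' => m''.nat permTmp = m'.nat permTmp ∧
      k < m''.nat rightEnd 0 ∧ ∃ t, Merging le N w S (m''.nat permTmp) t k (m''.nat leftPos 0)
      (m''.nat leftEnd 0) (m''.nat rightPos 0) (m''.nat rightEnd 0)) ?_ ?_ (by omega)
    · refine .of_wp (by simp [openBlocks, Program.NatOnly]) (by decide) ?_
      simp only [openBlocks, Program.wp, Test.Holds, NExp.eval, minExp_eval, Memory.nat_setNat,
        hkm, hN', hw']
      constructor
      · intro hek
        obtain ⟨_, hm⟩ | ⟨h, _⟩ := hI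
        · obtain ⟨t, ht⟩ := hm.merging hk
          refine ⟨by omega, by simp; omega, by simp; omega, by simp; omega, ?_, ?_⟩
          · simp
          · refine ⟨by simp; omega, t, ?_⟩
            simpa using ht
        · omega
      · intro hek
        exact ⟨trivial, hI.resolve_left (by omega)⟩
    · rintro m₁ hf₁ ⟨hD, hke, t, ht⟩
      have hkm₁ : m₁.nat counter 0 = k := by rw [hf₁.2 _ (by decide), hkm]
      have hS₁ : m₁.nat perm = S := by rw [hf₁.2 _ (by decide), hS']
      have hr₁ : m₁.real = m.real := by rw [hf₁.1, hr]
      refine (runs_moveHead (S := S) (w := w) (t := t) hkm₁ hk hW hS₁ (by rwa [hr₁]) hSN hke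
        (by rwa [hr₁])).mono le_rfl ?_
      rintro m₂ - ⟨he, ht'⟩
      rw [hr₁] at ht'
      simp only [Memory.nat_setNat_of_ne, ne_eq, Nat.reduceEqDiff,
        not_false_eq_true]
      obtain hlt | hle := Nat.lt_or_ge (k + 1) (m₂.nat rightEnd 0)
      · exact .inr ⟨hlt, t, ht'⟩
      · exact .inl ⟨hle, ht'.merged hle⟩
  · rintro m' - hI
    obtain ⟨-, h⟩ | ⟨hlt, t, ht⟩ := hI
    · exact h
    · have := ht.end_eq
      omega

theorem runs_copyBack {W N : ℕ} {m : Memory} (hN : m.nat nPoints 0 = N) (hW : 2 * N + 1 < W)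
    (hD : ∀ p < N, m.nat permTmp p < N) :
    Runs W copyBack m (30 * N + 11) fun m' => ∀ p < N, m'.nat perm p = m.nat permTmp p := by
  refine (Runs.forLoop (N := N) (T := 10) (fun k m' => ∀ p < k, m'.nat perm p = m.nat permTmp p)
    (by decide) (by decide) hN (by omega) (by simp) ?_ (by omega)).mono le_rfl (fun _ _ h => h)
  intro k m' hk hf hkm hI
  have hD' : m'.nat permTmp = m.nat permTmp := hf.2 _ (by decide)
  refine .of_wp trivial (by decide) ?_
  simp only [Program.wp, NExp.eval, hkm, hD']
  have := hD k hk
  refine ⟨by omega, fun p hp => ?_⟩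
  obtain rfl | hp' := Nat.eq_or_lt_of_le (Nat.le_of_lt_succ hp)
  · simp
  · have hne : p ≠ k := by omega
    simpa [Function.update_apply, hne] using hI p hp'

/-- The values of `S` below `N` are a permutation of the numbers below `N`, with inverse `R`. -/
structure Ranking (N : ℕ) (S R : ℕ → ℕ) : Prop where
  lt : ∀ i < N, S i < N
  rank_lt : ∀ e < N, R e < N
  rank : ∀ i < N, R (S i) = i
  apply_rank : ∀ e < N, S (R e) = e

/-- The sequence `S` enumerates the numbers below `N`, each once, in increasing order. -/
structure SortedPerm (le : ℕ → ℕ → Prop) (N : ℕ) (S : ℕ → ℕ) : Prop where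
  lt : ∀ i < N, S i < N
  surj : ∀ e < N, ∃ i < N, S i = e
  sorted : ∀ i j, i ≤ j → j < N → le (S i) (S j)

/-- Merging only tracks that every value survives; injectivity is free for a surjective self-map of
a finite set. -/
theorem SortedPerm.inj {le : ℕ → ℕ → Prop} {N : ℕ} {S : ℕ → ℕ} (h : SortedPerm le N S) {i j : ℕ}
    (hi : i < N) (hj : j < N) (hij : S i = S j) : i = j := by
  let f : Fin N → Fin N := fun i => ⟨S i, h.lt i i.2⟩
  have hf : Function.Surjective f := by
    intro e
    obtain ⟨i, hi, hie⟩ := h.surj e e.2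
    exact ⟨⟨i, hi⟩, Fin.ext hie⟩
  have := Finite.injective_iff_surjective.2 hf (a₁ := ⟨i, hi⟩) (a₂ := ⟨j, hj⟩) (Fin.ext hij)
  simpa using this

/-- After `r` passes the blocks of length `2 ^ r` are sorted. Each pass is linear, and after at most
`Nat.clog 2 N` of them a single block covers everything. -/
theorem runs_sortProgram {W N a b : ℕ} {m : Memory} (hN : m.nat nPoints 0 = N)
    (hW : 2 * N + 1 < W) (hN1 : 1 < N) :
    Runs W (sortProgram a b) m (300 * (N + 1) * (Nat.clog 2 N + 1)) fun m' =>
      SortedPerm (LexLE (m.real a) (m.real b)) N (m'.nat perm) := by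
  set le := LexLE (m.real a) (m.real b) with hle
  have h₁ : Runs W (forLoop counter nPoints (.store perm (var counter) (var counter))) m
      (30 * N + 11) fun m' => ∀ p < N, m'.nat perm p = p := by
    refine (Runs.forLoop (N := N) (T := 10) (fun k m' => ∀ p < k, m'.nat perm p = p)
      (by decide) (by decide) hN (by omega) (by simp) ?_ (by omega)).mono le_rfl (fun _ _ h => h)
    intro k m' hk hf hkm hI
    refine .of_wp trivial (by decide) ?_
    simp only [Program.wp, NExp.eval, hkm]
    refine ⟨by omega, fun p hp => ?_⟩
    obtain rfl | hp' := Nat.eq_or_lt_of_le (Nat.le_of_lt_succ hp)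
    · simp
    · have hne : p ≠ k := by omega
      simpa [Function.update_apply, hne] using hI p hp'
  refine Runs.seq h₁ (U := 250 * (N + 1) * (Nat.clog 2 N + 1)) ?_ ?_
  swap
  · nlinarith [Nat.zero_le (N * Nat.clog 2 N)]
  intro m₁ hf₁ hm₁
  have h₂ : Runs W (assign width (.const 1)) m₁ 3 fun m' => m' = m₁.setNat width 0 1 :=
    .of_wp trivial (by decide) (by simp [Program.wp, NExp.eval]; omega)
  refine Runs.seq h₂ (U := 250 * (N + 1) * Nat.clog 2 N + 8) ?_ (by nlinarith)
  rintro m₂ hf₂ rfl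
  set m₂ := m₁.setNat width 0 1
  have hN₂ : m₂.nat nPoints 0 = N := by
    rw [hf₂.2 _ (by decide), hf₁.2 _ (by decide), hN]
  have hr₂ : m₂.real = m.real := by rw [hf₂.1, hf₁.1]
  refine (Runs.loop (T := 230 * N + 60) (fun m' => ∃ r, m'.nat width 0 = 2 ^ r ∧
    r ≤ Nat.clog 2 N ∧ (∀ p < N, m'.nat perm p < N) ∧ (∀ e < N, ∃ p < N, m'.nat perm p = e) ∧
    BlockSorted le N (2 ^ r) (m'.nat perm)) (fun m' => Nat.clog 2 N - Nat.log 2 (m'.nat width 0))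
    ?_ ?_ ?_).mono le_rfl ?_
  · refine ⟨0, by simp [m₂], by omega, ?_, ?_, ?_⟩
    · intro p hp
      simp only [m₂, Memory.nat_setNat_of_ne, ne_eq, Nat.reduceEqDiff, not_false_eq_true]
      rwa [hm₁ p hp]
    · intro p hp
      simp only [m₂, Memory.nat_setNat_of_ne, ne_eq, Nat.reduceEqDiff, not_false_eq_true]
      exact ⟨p, hp, hm₁ p hp⟩
    · intro t p q h1 h2 h3 h4
      obtain rfl : p = q := by omega
      exact LexLE.refl _ _ _
  · rintro m₃ hf₃ ⟨r, hwr, hr, hlt, hsurj, hsort⟩ hlt'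
    have hN₃ : m₃.nat nPoints 0 = N := by
      rw [hf₃.2 _ (show _ ∉ rightEnd :: counter :: mergeWrites ++
        [counter, counter, perm, counter, width] by decide), hN₂]
    have hr₃ : m₃.real = m.real := by rw [hf₃.1, hr₂]
    have hwN : 2 ^ r < N := by
      simpa [Test.Holds, NExp.eval, hwr, hN₃] using hlt'
    have hrlt : r < Nat.clog 2 N := (Nat.lt_clog_iff_pow_lt (by norm_num)).2 hwN
    refine Runs.seq (runs_mergePass (a := a) (b := b) hN₃ hwr (by positivity) hW
      (by rwa [hr₃]) hlt) (U := 30 * N + 40) ?_ (by omega)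
    intro m₄ hf₄ hm₄
    rw [hr₃] at hm₄
    have hN₄ : m₄.nat nPoints 0 = N := by
      rw [hf₄.2 _ (show _ ∉ rightEnd :: counter :: mergeWrites ++ [counter] by decide),
        hN₃]
    have hw₄ : m₄.nat width 0 = 2 ^ r := by
      rw [hf₄.2 _ (show _ ∉ rightEnd :: counter :: mergeWrites ++ [counter] by decide),
        hwr]
    refine Runs.seq (runs_copyBack hN₄ hW hm₄.lt) (U := 29) ?_ (by omega)
    intro m₅ hf₅ hm₅
    have hw₅ : m₅.nat width 0 = 2 ^ r := by rw [hf₅.2 _ (by decide), hw₄]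
    refine .of_wp trivial (by decide) ?_
    simp only [Program.wp, NExp.eval, hw₅]
    refine ⟨by omega, ⟨r + 1, by simp [pow_succ]; ring, hrlt, ?_⟩, ?_⟩
    · simp only [Memory.nat_setNat_of_ne, ne_eq, Nat.reduceEqDiff, not_false_eq_true]
      refine ⟨fun p hp => hm₅ p hp ▸ hm₄.lt p hp, fun e he => ?_, ?_⟩
      · obtain ⟨p, hp, rfl⟩ := hsurj e he
        obtain ⟨q, hq, hqp⟩ := hm₄.mem p hp
        exact ⟨q, hq, by rw [hm₅ q hq, hqp]⟩
      · intro t p q h1 h2 h3 h4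
        rw [hm₅ p (by omega), hm₅ q h4]
        rw [pow_succ'] at h1 h3
        exact hm₄.sorted t p q h1 h2 h3 h4
    · have : 2 * 2 ^ r = 2 ^ (r + 1) := by ring
      simp [hwr, this, Nat.log_pow]
      omega
  · have : Nat.clog 2 N - Nat.log 2 (m₂.nat width 0) = Nat.clog 2 N := by simp [m₂]
    simp only [this, Test.cost, NExp.cost]
    nlinarith [Nat.zero_le (N * Nat.clog 2 N)]
  · rintro m₃ hf₃ ⟨⟨r, hwr, hr, hlt, hsurj, hsort⟩, hlt'⟩
    have hN₃ : m₃.nat nPoints 0 = N := by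
      rw [hf₃.2 _ (show _ ∉ rightEnd :: counter :: mergeWrites ++
        [counter, counter, perm, counter, width] by decide), hN₂]
    have hwN : N ≤ 2 ^ r := by
      simpa [Test.Holds, NExp.eval, hwr, hN₃] using hlt'
    exact ⟨hlt, hsurj, fun i j hij hj => hsort 0 i j (by omega) hij (by omega) hj⟩

end RealRAM

namespace Stabbing
open RealRAM Finset

/-! ### Stabbing rectangles in rank space -/

/-- The other endpoint of the segment of endpoint number `e`. -/
def mate (e : ℕ) : ℕ := 4 * (e / 2) + 1 - e

theorem mate_mate (e : ℕ) : mate (mate e) = e := by unfold mate; omega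

theorem mate_lt {n e : ℕ} (h : e < 2 * n) : mate e < 2 * n := by unfold mate; omega

/-- The point `e` with ranks `X e` and `Y e` lies in the bottomless rectangle with left side `a`,
right side `b` and top side `c`. -/
def Inside (X Y : ℕ → ℕ) (a b c e : ℕ) : Prop := a ≤ X e ∧ X e ≤ b ∧ Y e ≤ c

instance (X Y : ℕ → ℕ) (a b c e : ℕ) : Decidable (Inside X Y a b c e) :=
  inferInstanceAs (Decidable (_ ∧ _))

/-- A stabbing bottomless rectangle in rank space with a point on each of its sides.  Here `P` and
`Q` enumerate the points from left to right and from bottom to top. -/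
structure RankStabber (N : ℕ) (P Q X Y : ℕ → ℕ) (a b c : ℕ) : Prop where
  left_lt : a < N
  right_lt : b < N
  top_lt : c < N
  left : Inside X Y a b c (P a)
  right : Inside X Y a b c (P b)
  top : Inside X Y a b c (Q c)
  stabs : ∀ e < N, Inside X Y a b c e ↔ ¬ Inside X Y a b c (mate e)

/-- The least `z` such that each segment has an endpoint with `F ≤ z`, and so has the mate of each
of the first `a` points of `P`. -/
def reach (N : ℕ) (P F : ℕ → ℕ) (a : ℕ) : ℕ :=
  (range N).sup (fun e => min (F e) (F (mate e))) ⊔ (range a).sup fun j => F (mate (P j))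

/-- The sequence `P` of length `N` in reverse order. -/
def rev (N : ℕ) (P : ℕ → ℕ) (k : ℕ) : ℕ := P (N - 1 - k)

/-- The top side of the lowest rectangle with left side `a` that may be stabbing. -/
def topOf (N : ℕ) (P Y : ℕ → ℕ) (a : ℕ) : ℕ := reach N P Y a

/-- The right side of the narrowest rectangle with left side `a` and top side `topOf N P Y a` that
may be stabbing. -/
def rightOf (N : ℕ) (P Q X Y : ℕ → ℕ) (a : ℕ) : ℕ :=
  reach N P X a ⊔ reach N (rev N Q) X (N - 1 - topOf N P Y a)

/-- The number of positions to the right of the leftmost right endpoint of a segment. -/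
def slack (N : ℕ) (X : ℕ → ℕ) : ℕ := (range N).sup fun e => N - max (X e) (X (mate e))

/-- The minimum over the segments of the larger rank is stored through complements, as a supremum,
so that the maximum loop can compute it. The inequality is additive to avoid truncated subtraction.
-/
theorem slack_iff {N a : ℕ} {X : ℕ → ℕ} (ha : a ≤ N) :
    a + slack N X ≤ N ↔ ∀ e < N, a ≤ max (X e) (X (mate e)) := by
  have : a + slack N X ≤ N ↔ slack N X ≤ N - a := by omega
  rw [this, slack, Finset.sup_le_iff]
  simp only [mem_range]
  refine forall₂_congr fun e he => ?_
  omega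

theorem reach_le_iff {N a z : ℕ} {P F : ℕ → ℕ} :
    reach N P F a ≤ z ↔ (∀ e < N, min (F e) (F (mate e)) ≤ z) ∧ ∀ j < a, F (mate (P j)) ≤ z := by
  simp [reach]

theorem reach_le_iff_rank {N a z : ℕ} {P X F : ℕ → ℕ} (h : Ranking N P X) (ha : a ≤ N) :
    reach N P F a ≤ z ↔
      (∀ e < N, min (F e) (F (mate e)) ≤ z) ∧ ∀ e < N, X e < a → F (mate e) ≤ z := by
  rw [reach_le_iff]
  refine and_congr_right fun _ => ⟨fun H e he hea => ?_, fun H j hj => ?_⟩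
  · have := H _ hea
    rwa [h.apply_rank e he] at this
  · exact H _ (h.lt j (by omega)) (by rw [h.rank j (by omega)]; exact hj)

theorem _root_.RealRAM.Ranking.rev {N : ℕ} {P X : ℕ → ℕ} (h : Ranking N P X) :
    Ranking N (rev N P) (fun e => N - 1 - X e) := by
  refine ⟨fun i hi => h.lt _ (by omega), fun e he => by omega, fun i hi => ?_, fun e he => ?_⟩
  · show N - 1 - X (P (N - 1 - i)) = i
    rw [h.rank _ (by omega)]; omega
  · show P (N - 1 - (N - 1 - X e)) = e
    have := h.rank_lt e he
    rw [show N - 1 - (N - 1 - X e) = X e by omega, h.apply_rank e he]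

theorem reach_lt {n a : ℕ} {P F : ℕ → ℕ} (hn : 0 < n) (hP : ∀ i < 2 * n, P i < 2 * n)
    (hF : ∀ e < 2 * n, F e < 2 * n) (ha : a ≤ 2 * n) : reach (2 * n) P F a < 2 * n := by
  have : reach (2 * n) P F a ≤ 2 * n - 1 := by
    rw [reach_le_iff]
    refine ⟨fun e he => ?_, fun j hj => ?_⟩
    · have := hF e he; omega
    · have := hF _ (mate_lt (hP j (by omega))); omega
  omega

theorem reach_mono {N a a' : ℕ} {P F : ℕ → ℕ} (h : a ≤ a') : reach N P F a ≤ reach N P F a' :=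
  reach_le_iff.2 ⟨(reach_le_iff.1 le_rfl).1, fun j hj => (reach_le_iff.1 le_rfl).2 j (by omega)⟩

section

variable {n a b c : ℕ} {P Q X Y P' X' : ℕ → ℕ}

/-- The points above the top side are a prefix of the reversed `Q`, so the requirement that their
mates be inside is again a prefix maximum. -/
theorem rightOf_le_iff (hP : Ranking (2 * n) P X) (hQ : Ranking (2 * n) Q Y) (ha : a ≤ 2 * n) :
    rightOf (2 * n) P Q X Y a ≤ b ↔ (∀ e < 2 * n, min (X e) (X (mate e)) ≤ b) ∧
      (∀ e < 2 * n, X e < a → X (mate e) ≤ b) ∧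
      ∀ e < 2 * n, topOf (2 * n) P Y a < Y e → X (mate e) ≤ b := by
  rw [rightOf, sup_le_iff, reach_le_iff_rank hP ha, reach_le_iff_rank hQ.rev (by omega)]
  have : (∀ e < 2 * n, 2 * n - 1 - Y e < 2 * n - 1 - topOf (2 * n) P Y a → X (mate e) ≤ b) ↔
      ∀ e < 2 * n, topOf (2 * n) P Y a < Y e → X (mate e) ≤ b := by
    refine forall₂_congr fun e he => ?_
    have := hQ.rank_lt e he
    exact imp_congr_left (by omega)
  tauto

/-- A rectangle that contains an endpoint of each segment is stabbing if and only if it contains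
`n` endpoints. -/
theorem stabs_of_card (hhit : ∀ e < 2 * n, ¬ Inside X Y a b c e → Inside X Y a b c (mate e))
    (hcard : #{e ∈ range (2 * n) | Inside X Y a b c e} = n) :
    ∀ e < 2 * n, Inside X Y a b c e ↔ ¬ Inside X Y a b c (mate e) := by
  have hout : #{e ∈ range (2 * n) | ¬ Inside X Y a b c e} = n := by
    have := card_filter_add_card_filter_not (s := range (2 * n)) (fun e => Inside X Y a b c e)
    rw [card_range] at this
    omega
  -- `mate` maps the outside points injectively into the inside ones; equal cardinalities make it
  -- onto.
  have himg : ({e ∈ range (2 * n) | ¬ Inside X Y a b c e}).image mate =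
      {e ∈ range (2 * n) | Inside X Y a b c e} := by
    apply eq_of_subset_of_card_le
    · intro f hf
      simp only [mem_image, mem_filter, mem_range] at hf ⊢
      obtain ⟨e, ⟨he, he'⟩, rfl⟩ := hf
      exact ⟨mate_lt he, hhit e he he'⟩
    · rw [card_image_of_injective _ (Function.LeftInverse.injective mate_mate), hcard, hout]
  intro e he
  refine ⟨fun hin => ?_, fun hout => ?_⟩
  · have : e ∈ ({e ∈ range (2 * n) | ¬ Inside X Y a b c e}).image mate := by
      rw [himg]; simp [he, hin]
    simp only [mem_image, mem_filter, mem_range] at this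
    obtain ⟨f, ⟨hf, hf'⟩, rfl⟩ := this
    rwa [mate_mate]
  · have := hhit _ (mate_lt he) hout
    rwa [mate_mate] at this

theorem card_of_stabs (h : ∀ e < 2 * n, Inside X Y a b c e ↔ ¬ Inside X Y a b c (mate e)) :
    #{e ∈ range (2 * n) | Inside X Y a b c e} = n := by
  have himg : ({e ∈ range (2 * n) | ¬ Inside X Y a b c e}).image mate =
      {e ∈ range (2 * n) | Inside X Y a b c e} := by
    ext f
    simp only [mem_image, mem_filter, mem_range]
    constructor
    · rintro ⟨e, ⟨he, he'⟩, rfl⟩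
      exact ⟨mate_lt he, by have := h e he; tauto⟩
    · rintro ⟨hf, hf'⟩
      exact ⟨mate f, ⟨mate_lt hf, (h f hf).1 hf'⟩, mate_mate f⟩
  have hcard := congrArg card himg
  rw [card_image_of_injective _ (Function.LeftInverse.injective mate_mate)] at hcard
  have := card_filter_add_card_filter_not (s := range (2 * n)) (fun e => Inside X Y a b c e)
  rw [card_range] at this
  omega

/-- The test that the sweep applies to the left side `a`. -/
def Accepts (n : ℕ) (P Q X Y : ℕ → ℕ) (a : ℕ) : Prop :=
  a + slack (2 * n) X ≤ 2 * n ∧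
  #{e ∈ range (2 * n) | Inside X Y a (rightOf (2 * n) P Q X Y a) (topOf (2 * n) P Y a) e} = n ∧
  Inside X Y a (rightOf (2 * n) P Q X Y a) (topOf (2 * n) P Y a) (P a) ∧
  Inside X Y a (rightOf (2 * n) P Q X Y a) (topOf (2 * n) P Y a)
    (P (rightOf (2 * n) P Q X Y a)) ∧
  Inside X Y a (rightOf (2 * n) P Q X Y a) (topOf (2 * n) P Y a) (Q (topOf (2 * n) P Y a))

/-- Let an endpoint be outside. If it is left of `a`, slack and the two prefix bounds put its mate
inside. If it is above `c` or right of `b`, the minimum conditions put the mate below `c`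
respectively left of `b`, and a mate outside some other side would force the endpoint itself back
below `c` or left of `b`. So every segment is hit, and the count decides. -/
theorem accepts_iff (hP : Ranking (2 * n) P X) (hQ : Ranking (2 * n) Q Y) (ha : a < 2 * n) :
    Accepts n P Q X Y a ↔ RankStabber (2 * n) P Q X Y a (rightOf (2 * n) P Q X Y a)
      (topOf (2 * n) P Y a) := by
  set b := rightOf (2 * n) P Q X Y a with hb
  set c := topOf (2 * n) P Y a with hc
  constructor
  · rintro ⟨h1, h2, h3, h4, h5⟩
    rw [slack_iff ha.le] at h1
    have hc' := (reach_le_iff_rank hP ha.le (F := Y) (z := c)).1 hc.ge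
    have hb' := (rightOf_le_iff hP hQ ha.le (b := b)).1 hb.ge
    rw [← hc] at hb'
    obtain ⟨hc1, hc2⟩ := hc'
    obtain ⟨hb1, hb2, hb3⟩ := hb'
    refine ⟨ha, max_lt (reach_lt (by omega) hP.lt hP.rank_lt ha.le)
      (reach_lt (by omega) hQ.rev.lt hP.rank_lt (by omega)),
      reach_lt (by omega) hP.lt hQ.rank_lt ha.le, h3, h4, h5, stabs_of_card ?_ h2⟩
    intro e he hout
    have g1 := h1 e he
    have g2 := hc1 e he
    have g3 := hb1 e he
    have g4 := hc2 e he
    have g5 := hb2 e he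
    have g6 := hb3 e he
    have k1 := hc2 _ (mate_lt he)
    have k2 := hb2 _ (mate_lt he)
    have k3 := hb3 _ (mate_lt he)
    rw [mate_mate] at k1 k2 k3
    unfold Inside at hout ⊢
    omega
  · intro h
    refine ⟨(slack_iff ha.le).2 fun e he => ?_, card_of_stabs h.stabs, h.left, h.right, h.top⟩
    have := h.stabs e he
    unfold Inside at this
    omega

/-- The constraints that define `topOf` are necessary: each segment has an endpoint inside, and a
point left of `a` is outside, so its mate is inside. -/
theorem RankStabber.topOf_le (h : RankStabber (2 * n) P Q X Y a b c) (hP : Ranking (2 * n) P X) :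
    topOf (2 * n) P Y a ≤ c := by
  refine (reach_le_iff_rank hP h.left_lt.le).2 ⟨fun e he => ?_, fun e he hea => ?_⟩ <;>
  · have := h.stabs e he
    unfold Inside at this
    omega

/-- The mate of the point on the right side is outside. Whether it is left of `a`, above `c` or
right of `b`, one of the constraints defining `rightOf` then forces `b ≤ rightOf`. The converse
inequality holds because these constraints are necessary. -/
theorem RankStabber.right_eq (h : RankStabber (2 * n) P Q X Y a b c) (hP : Ranking (2 * n) P X)
    (hQ : Ranking (2 * n) Q Y) (hc : c = topOf (2 * n) P Y a) : b = rightOf (2 * n) P Q X Y a := by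
  apply le_antisymm
  · have hb' := (rightOf_le_iff hP hQ h.left_lt.le).1 (le_refl (rightOf (2 * n) P Q X Y a))
    rw [← hc] at hb'
    obtain ⟨hb1, hb2, hb3⟩ := hb'
    have hPb := hP.lt b h.right_lt
    have h1 := hb1 _ hPb
    have h2 := hb2 _ (mate_lt hPb)
    have h3 := hb3 _ (mate_lt hPb)
    have h4 := h.stabs _ hPb
    have h5 := h.right
    have h6 := hP.rank b h.right_lt
    rw [mate_mate] at h2 h3
    unfold Inside at h4 h5
    omega
  · refine (rightOf_le_iff hP hQ h.left_lt.le).2 ⟨fun e he => ?_, fun e he hea => ?_,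
      fun e he hea => ?_⟩ <;>
    · have := h.stabs e he
      unfold Inside at this
      omega

/-- Reflection exchanges the left and right sides. `P'` and `X'` are only controlled below `2 * n`,
since they will be contents of arrays. -/
theorem rankStabber_rev_iff (hP : Ranking (2 * n) P X) (hQ : Ranking (2 * n) Q Y)
    (hP' : ∀ k < 2 * n, P' k = P (2 * n - 1 - k)) (hX' : ∀ e < 2 * n, X' e = 2 * n - 1 - X e)
    (ha : a < 2 * n) (hb : b < 2 * n) :
    RankStabber (2 * n) P' Q X' Y (2 * n - 1 - b) (2 * n - 1 - a) c ↔
      RankStabber (2 * n) P Q X Y a b c := by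
  have hin : ∀ e < 2 * n, Inside X' Y (2 * n - 1 - b) (2 * n - 1 - a) c e ↔
      Inside X Y a b c e := by
    intro e he
    have := hP.rank_lt e he
    unfold Inside
    rw [hX' e he]
    omega
  have ea : P' (2 * n - 1 - a) = P a := by
    rw [hP' _ (by omega), show 2 * n - 1 - (2 * n - 1 - a) = a by omega]
  have eb : P' (2 * n - 1 - b) = P b := by
    rw [hP' _ (by omega), show 2 * n - 1 - (2 * n - 1 - b) = b by omega]
  have hs : (∀ e < 2 * n, Inside X Y a b c e ↔ ¬ Inside X Y a b c (mate e)) ↔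
      ∀ e < 2 * n, Inside X' Y (2 * n - 1 - b) (2 * n - 1 - a) c e ↔
        ¬ Inside X' Y (2 * n - 1 - b) (2 * n - 1 - a) c (mate e) :=
    forall₂_congr fun e he => by rw [hin e he, hin _ (mate_lt he)]
  constructor
  · rintro ⟨-, -, h3, h4, h5, h6, h7⟩
    rw [eb, hin _ (hP.lt b hb)] at h4
    rw [ea, hin _ (hP.lt a ha)] at h5
    exact ⟨ha, hb, h3, h5, h4, (hin _ (hQ.lt c h3)).1 h6, hs.2 h7⟩
  · rintro ⟨-, -, h3, h4, h5, h6, h7⟩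
    rw [← hin _ (hP.lt a ha), ← ea] at h4
    rw [← hin _ (hP.lt b hb), ← eb] at h5
    exact ⟨by omega, by omega, h3, h5, h4, (hin _ (hQ.lt c h3)).2 h6, hs.1 h7⟩

/-- Both bounds are at most `c`. The mate of the point on the top side is outside: if it is left of
`a` or above `c`, the first bound reaches `c`; if it is right of `b`, the reflected one does. -/
theorem RankStabber.top_eq (h : RankStabber (2 * n) P Q X Y a b c) (hP : Ranking (2 * n) P X)
    (hQ : Ranking (2 * n) Q Y) (hPr : Ranking (2 * n) P' X')
    (hP' : ∀ k < 2 * n, P' k = P (2 * n - 1 - k)) (hX' : ∀ e < 2 * n, X' e = 2 * n - 1 - X e) :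
    c = topOf (2 * n) P Y a ∨ c = topOf (2 * n) P' Y (2 * n - 1 - b) := by
  have h1 := h.topOf_le hP
  have h2 := ((rankStabber_rev_iff hP hQ hP' hX' h.left_lt h.right_lt).2 h).topOf_le hPr
  have hb := h.right_lt
  obtain ⟨hc1, hc2⟩ := (reach_le_iff_rank hP h.left_lt.le (F := Y)).1
    (le_refl (topOf (2 * n) P Y a))
  obtain ⟨hd1, hd2⟩ := (reach_le_iff_rank hPr (by omega : 2 * n - 1 - b ≤ 2 * n) (F := Y)).1
    (le_refl (topOf (2 * n) P' Y (2 * n - 1 - b)))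
  have hQc := hQ.lt c h.top_lt
  have g1 := hc1 _ hQc
  have g2 := hc2 _ (mate_lt hQc)
  have g3 := hd2 _ (mate_lt hQc)
  have g4 := h.stabs _ hQc
  have g5 := h.top
  have g6 := hQ.rank c h.top_lt
  have g7 := hP.rank_lt _ (mate_lt hQc)
  rw [mate_mate] at g2 g3
  rw [hX' _ (mate_lt hQc)] at g3
  unfold Inside at g4 g5
  omega

end


/-! ### The sweep over all left sides -/

/-- The number of points in the half-open box `a ≤ X < b`, `Y < c`. -/
def boxCount (N : ℕ) (X Y : ℕ → ℕ) (a b c : ℕ) : ℕ :=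
  #{e ∈ range N | a ≤ X e ∧ X e < b ∧ Y e < c}

/-- Moving one side of a box by one rank changes the membership of a single point `e₀`; this is the
resulting update of the count. -/
theorem card_filter_succ {s : Finset ℕ} {p q : ℕ → Prop} [DecidablePred p] [DecidablePred q]
    {e₀ : ℕ} (he : e₀ ∈ s) (hpq : ∀ e ∈ s, e ≠ e₀ → (p e ↔ q e)) (hp : ¬ p e₀) :
    #(s.filter q) = #(s.filter p) + if q e₀ then 1 else 0 := by
  have hs : s = insert e₀ (s.erase e₀) := (insert_erase he).symm
  have h1 : s.filter p = (s.erase e₀).filter p := by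
    rw [hs, filter_insert, if_neg hp]; simp
  have h2 : (s.erase e₀).filter p = (s.erase e₀).filter q :=
    filter_congr fun e he' => hpq e (mem_of_mem_erase he') (ne_of_mem_erase he')
  split_ifs with hq
  · rw [h1, h2]
    conv_lhs => rw [hs, filter_insert, if_pos hq]
    rw [card_insert_of_notMem (by simp)]
  · rw [h1, h2, add_zero]
    conv_lhs => rw [hs, filter_insert, if_neg hq]

section

variable {N a b c : ℕ} {P Q X Y : ℕ → ℕ}

theorem boxCount_le : boxCount N X Y a b c ≤ N :=
  (card_filter_le _ _).trans (by simp)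

theorem boxCount_top (hQ : Ranking N Q Y) (hc : c < N) : boxCount N X Y a b (c + 1) =
    boxCount N X Y a b c + if a ≤ X (Q c) ∧ X (Q c) < b then 1 else 0 := by
  have := hQ.rank c hc
  rw [boxCount, boxCount, card_filter_succ (p := fun e => a ≤ X e ∧ X e < b ∧ Y e < c)
    (mem_range.2 (hQ.lt c hc)) ?_ (by omega)]
  · simp [this]
  · intro e he hne
    have hec : Y e ≠ c := fun h => hne (by rw [← h, hQ.apply_rank e (mem_range.1 he)])
    omega

theorem boxCount_right (hP : Ranking N P X) (hb : b < N) : boxCount N X Y a (b + 1) c =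
    boxCount N X Y a b c + if a ≤ b ∧ Y (P b) < c then 1 else 0 := by
  have := hP.rank b hb
  rw [boxCount, boxCount, card_filter_succ (p := fun e => a ≤ X e ∧ X e < b ∧ Y e < c)
    (mem_range.2 (hP.lt b hb)) ?_ (by omega)]
  · simp [this]
  · intro e he hne
    have hec : X e ≠ b := fun h => hne (by rw [← h, hP.apply_rank e (mem_range.1 he)])
    omega

theorem boxCount_left (hP : Ranking N P X) (ha : a < N) : boxCount N X Y a b c =
    boxCount N X Y (a + 1) b c + if a < b ∧ Y (P a) < c then 1 else 0 := by
  have := hP.rank a ha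
  rw [boxCount, boxCount, card_filter_succ (p := fun e => a + 1 ≤ X e ∧ X e < b ∧ Y e < c)
    (mem_range.2 (hP.lt a ha)) ?_ (by omega)]
  · simp [this]
  · intro e he hne
    have hec : X e ≠ a := fun h => hne (by rw [← h, hP.apply_rank e (mem_range.1 he)])
    omega

/-- The sweep uses half-open boxes so that it can start from an empty one; its right and top
variables therefore end one above the candidate's sides. -/
theorem boxCount_eq_card_inside :
    boxCount N X Y a (b + 1) (c + 1) = #{e ∈ range N | Inside X Y a b c e} := by
  rw [boxCount]
  congr 1
  refine filter_congr fun e _ => ?_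
  unfold Inside
  omega

end

/-- The sweep has dealt with the left sides before `a`, and `cnt` is the number of points in the
current half-open box. -/
structure SweepState (n : ℕ) (P Q X Y : ℕ → ℕ) (a b c cnt : ℕ) (R : ℕ → ℕ) : Prop where
  left_le : a ≤ 2 * n
  right_le : b ≤ 2 * n
  top_le : c ≤ 2 * n
  top_le_succ : a < 2 * n → c ≤ topOf (2 * n) P Y a + 1
  count : cnt = boxCount (2 * n) X Y a b c
  accept : ∀ j < a, Accepts n P Q X Y j → R j = rightOf (2 * n) P Q X Y j + 1
  reject : ∀ j < a, ¬ Accepts n P Q X Y j → R j = 0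

/-- The number of steps that remain to be done in the sweep. -/
def sweepMeasure (N : ℕ) (P Q X Y : ℕ → ℕ) (a b c : ℕ) : ℕ :=
  (N - a) + (N - c) + (b - (rightOf N P Q X Y a + 1) + (rightOf N P Q X Y a + 1 - b)) +
    (N - reach N P X a) + reach N (rev N Q) X (N - 1 - topOf N P Y a)

section

variable {n a b c cnt : ℕ} {P Q X Y R R' : ℕ → ℕ}

theorem topOf_lt (hP : Ranking (2 * n) P X) (hQ : Ranking (2 * n) Q Y) (ha : a < 2 * n) :
    topOf (2 * n) P Y a < 2 * n :=
  reach_lt (by omega) hP.lt hQ.rank_lt ha.le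

theorem rightOf_lt (hP : Ranking (2 * n) P X) (hQ : Ranking (2 * n) Q Y) (ha : a < 2 * n) :
    rightOf (2 * n) P Q X Y a < 2 * n :=
  max_lt (reach_lt (by omega) hP.lt hP.rank_lt ha.le)
    (reach_lt (by omega) hQ.rev.lt hP.rank_lt (by omega))

theorem SweepState.zero : SweepState n P Q X Y 0 0 0 0 R :=
  ⟨by omega, by omega, by omega, by omega, by simp [boxCount], by omega, by omega⟩

theorem SweepState.top_succ (h : SweepState n P Q X Y a b c cnt R) (hP : Ranking (2 * n) P X)
    (hQ : Ranking (2 * n) Q Y) (ha : a < 2 * n) (hc : c ≤ topOf (2 * n) P Y a) :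
    SweepState n P Q X Y a b (c + 1) (cnt + if a ≤ X (Q c) ∧ X (Q c) < b then 1 else 0) R ∧
      sweepMeasure (2 * n) P Q X Y a b (c + 1) < sweepMeasure (2 * n) P Q X Y a b c := by
  have ht := topOf_lt hP hQ ha
  refine ⟨⟨h.left_le, h.right_le, by omega, by omega, ?_, h.accept, h.reject⟩, ?_⟩
  · rw [boxCount_top hQ (by omega), h.count]
  · unfold sweepMeasure; omega

theorem SweepState.right_succ (h : SweepState n P Q X Y a b c cnt R) (hP : Ranking (2 * n) P X)
    (hQ : Ranking (2 * n) Q Y) (ha : a < 2 * n) (hb : b ≤ rightOf (2 * n) P Q X Y a) :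
    SweepState n P Q X Y a (b + 1) c (cnt + if a ≤ b ∧ Y (P b) < c then 1 else 0) R ∧
      sweepMeasure (2 * n) P Q X Y a (b + 1) c < sweepMeasure (2 * n) P Q X Y a b c := by
  have ht := rightOf_lt hP hQ ha
  refine ⟨⟨h.left_le, by omega, h.top_le, h.top_le_succ, ?_, h.accept, h.reject⟩, ?_⟩
  · rw [boxCount_right hP (by omega), h.count]
  · unfold sweepMeasure; omega

theorem SweepState.right_pred (h : SweepState n P Q X Y a b c cnt R) (hP : Ranking (2 * n) P X)
    (hb : rightOf (2 * n) P Q X Y a + 1 < b) :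
    SweepState n P Q X Y a (b - 1) c
      (cnt - if a ≤ b - 1 ∧ Y (P (b - 1)) < c then 1 else 0) R ∧
      sweepMeasure (2 * n) P Q X Y a (b - 1) c < sweepMeasure (2 * n) P Q X Y a b c := by
  have hb' := h.right_le
  refine ⟨⟨h.left_le, by omega, h.top_le, h.top_le_succ, ?_, h.accept, h.reject⟩, ?_⟩
  · have := boxCount_right (X := X) (Y := Y) (a := a) (c := c) (b := b - 1) hP (by omega)
    rw [show b - 1 + 1 = b by omega] at this
    rw [h.count, this, Nat.add_sub_cancel]
  · unfold sweepMeasure; omega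

/-- This is where the amortisation happens. The right side is at its goal, so the new distance is
the change of the goal, a maximum of two terms. It is at most the growth of the first plus the drop
of the second, and the last two terms of `sweepMeasure` pay exactly that. The strict decrease comes
from `a`. -/
theorem SweepState.left_succ (h : SweepState n P Q X Y a b c cnt R) (hP : Ranking (2 * n) P X)
    (ha : a < 2 * n) (hb : b = rightOf (2 * n) P Q X Y a + 1)
    (hR : ∀ j < a, R' j = R j)
    (hacc : Accepts n P Q X Y a → R' a = rightOf (2 * n) P Q X Y a + 1)
    (hrej : ¬ Accepts n P Q X Y a → R' a = 0) :
    SweepState n P Q X Y (a + 1) b c (cnt - if a < b ∧ Y (P a) < c then 1 else 0) R' ∧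
      sweepMeasure (2 * n) P Q X Y (a + 1) b c < sweepMeasure (2 * n) P Q X Y a b c := by
  have hmono : topOf (2 * n) P Y a ≤ topOf (2 * n) P Y (a + 1) := reach_mono (by omega)
  refine ⟨⟨ha, h.right_le, h.top_le, fun _ => ?_, ?_, ?_, ?_⟩, ?_⟩
  -- The top never overshoots later goals, because `topOf` is monotone in `a`.
  · have := h.top_le_succ ha
    omega
  · rw [h.count, boxCount_left hP ha, Nat.add_sub_cancel]
  · intro j hj hj'
    obtain rfl | hlt := Nat.eq_or_lt_of_le (Nat.le_of_lt_succ hj)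
    · exact hacc hj'
    · rw [hR j hlt, h.accept j hlt hj']
  · intro j hj hj'
    obtain rfl | hlt := Nat.eq_or_lt_of_le (Nat.le_of_lt_succ hj)
    · exact hrej hj'
    · rw [hR j hlt, h.reject j hlt hj']
  · have h1 : reach (2 * n) P X a ≤ reach (2 * n) P X (a + 1) := reach_mono (by omega)
    have h2 : reach (2 * n) (rev (2 * n) Q) X (2 * n - 1 - topOf (2 * n) P Y (a + 1)) ≤
      reach (2 * n) (rev (2 * n) Q) X (2 * n - 1 - topOf (2 * n) P Y a) := reach_mono (by omega)
    have h3 : reach (2 * n) P X (a + 1) < 2 * n :=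
      reach_lt (by omega) hP.lt hP.rank_lt (by omega)
    have h4 : rightOf (2 * n) P Q X Y a = max (reach (2 * n) P X a)
      (reach (2 * n) (rev (2 * n) Q) X (2 * n - 1 - topOf (2 * n) P Y a)) := rfl
    have h5 : rightOf (2 * n) P Q X Y (a + 1) = max (reach (2 * n) P X (a + 1))
      (reach (2 * n) (rev (2 * n) Q) X (2 * n - 1 - topOf (2 * n) P Y (a + 1))) := rfl
    unfold sweepMeasure
    omega

/-- With all sides at their goals the half-open box is the candidate, so `cnt` is its number of
points. Of the conditions on the three boundary points, those that hold by definition of the ranks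
are dropped. -/
theorem SweepState.accepts_iff (h : SweepState n P Q X Y a b c cnt R) (hP : Ranking (2 * n) P X)
    (hQ : Ranking (2 * n) Q Y) (ha : a < 2 * n) (hb : b = rightOf (2 * n) P Q X Y a + 1)
    (hc : topOf (2 * n) P Y a < c) :
    Accepts n P Q X Y a ↔ a + slack (2 * n) X ≤ 2 * n ∧ (cnt ≤ n ∧ n ≤ cnt) ∧
      (a ≤ rightOf (2 * n) P Q X Y a ∧ Y (P a) ≤ topOf (2 * n) P Y a) ∧
      Y (P (rightOf (2 * n) P Q X Y a)) ≤ topOf (2 * n) P Y a ∧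
      a ≤ X (Q (topOf (2 * n) P Y a)) ∧
      X (Q (topOf (2 * n) P Y a)) ≤ rightOf (2 * n) P Q X Y a := by
  have hc' : c = topOf (2 * n) P Y a + 1 := by
    have := h.top_le_succ ha
    omega
  have h1 := h.count
  rw [hb, hc', boxCount_eq_card_inside] at h1
  have h2 := hP.rank a ha
  have h3 := hP.rank _ (rightOf_lt hP hQ ha)
  have h4 := hQ.rank _ (topOf_lt hP hQ ha)
  unfold Accepts
  rw [← h1]
  simp only [Inside, h2, h3, h4]
  omega

end

-- Programs for the prefix maxima and the slack.

notation "permY" => (7 : ℕ)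
notation "rankX" => (8 : ℕ)
notation "rankY" => (16 : ℕ)
notation "maxVar" => (17 : ℕ)
notation "slackVar" => (18 : ℕ)
notation "topArr" => (20 : ℕ)
notation "resultArr" => (21 : ℕ)
notation "rightArr" => (22 : ℕ)
notation "reachArr" => (23 : ℕ)
notation "sweepLeft" => (24 : ℕ)
notation "sweepRight" => (25 : ℕ)
notation "sweepTop" => (26 : ℕ)
notation "sweepCount" => (27 : ℕ)

/-- The maximum of two expressions. -/
def maxExp (e f : NExp) : NExp := .add e (.sub f e)

@[simp] theorem maxExp_eval (e f : NExp) (m : Memory) :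
    (maxExp e f).eval m = max (e.eval m) (f.eval m) := by
  simp only [maxExp, NExp.eval]; omega

/-- The number of the other endpoint of a segment. -/
def mateExp (e : NExp) : NExp :=
  .sub (.add (.mul (.const 4) (.div e (.const 2))) (.const 1)) e

@[simp] theorem mateExp_eval (e : NExp) (m : Memory) : (mateExp e).eval m = mate (e.eval m) := by
  simp only [mateExp, NExp.eval, mate]

/-- Raise `maxVar` to the maximum of all values of `e`. -/
def maxLoop (e : NExp) : Program :=
  forLoop counter nPoints (assign maxVar (maxExp (var maxVar) e))

/-- The expression is evaluated in memories that differ from `m` in the counter and the running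
maximum only, hence the quantification over framed memories in `he`. -/
theorem runs_maxLoop {W N M : ℕ} {m : Memory} {e : NExp} {g : ℕ → ℕ} (hN : m.nat nPoints 0 = N)
    (hW : 2 * N + 1 < W) (hg : ∀ k < N, g k ≤ N) (h0 : m.nat maxVar 0 = 0)
    (he : ∀ k < N, ∀ m', Frame [counter, maxVar] m m' → m'.nat counter 0 = k → e.eval m' = g k)
    (hM : N * (e.cost + 22) + 11 ≤ M) :
    Runs W (maxLoop e) m M fun m' => m'.nat maxVar 0 = (range N).sup g := by
  refine (Runs.forLoop (N := N) (T := e.cost + 8) (fun k m' => m'.nat maxVar 0 = (range k).sup g)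
    (by simp [Program.writes]) (by simp [Program.writes]) hN (by omega) (by simpa using h0)
    ?_ hM).mono le_rfl (fun _ _ h => h)
  · intro k m' hk hf hkm hI
    refine .of_wp trivial (by simp [Program.time, NExp.cost, maxExp]; omega) ?_
    have h := he k hk m' hf hkm
    have h' : (range k).sup g ≤ N := Finset.sup_le fun j hj => hg j (by simp at hj; omega)
    have h'' := hg k hk
    simp only [Program.wp, NExp.eval, maxExp_eval, h, hI]
    refine ⟨by omega, ?_⟩
    simp [Finset.range_add_one, max_comm]

/-- Compute `reach` for the enumeration given by the expression `ix` and the values in the array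
`f`, and store it in the array `out`. -/
def reachProgram (f out : ℕ) (ix : NExp) : Program :=
  .seq (assign maxVar (.const 0))
    (.seq (maxLoop (minExp (.read f (var counter)) (.read f (mateExp (var counter)))))
      (forLoop counter nPoints
        (.seq (.store out (var counter) (var maxVar))
          (assign maxVar (maxExp (var maxVar) (.read f (mateExp ix)))))))

/-- The first loop computes the part that does not depend on `a`, the second accumulates the prefix.
Cell `k` is written before the point `P k` is taken into account, so it holds `reach` at `k`. -/
theorem runs_reachProgram {n W M f out : ℕ} {m : Memory} {ix : NExp} {P : ℕ → ℕ}
    (hN : m.nat nPoints 0 = 2 * n) (hW : 4 * n + 1 < W)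
    (hout : out ∉ [nPoints, counter, maxVar]) (hf : f ∉ [counter, maxVar, out])
    (hP : ∀ k < 2 * n, P k < 2 * n) (hF : ∀ e < 2 * n, m.nat f e < 2 * n)
    (hix : ∀ k < 2 * n, ∀ m', Frame [counter, maxVar, out] m m' → m'.nat counter 0 = k →
      ix.eval m' = P k)
    (hM : 2 * n * (2 * ix.cost + 120) + 30 ≤ M) :
    Runs W (reachProgram f out ix) m M fun m' =>
      ∀ a < 2 * n, m'.nat out a = reach (2 * n) P (m.nat f) a := by
  simp only [List.mem_cons, List.not_mem_nil, or_false, not_or] at hout hf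
  obtain ⟨ho1, ho2, ho3⟩ := hout
  obtain ⟨hf1, hf2, hf3⟩ := hf
  refine Runs.seq (T := 3) (U := 2 * n * (2 * ix.cost + 120) + 27)
    (Q := fun m' => m' = m.setNat maxVar 0 0)
    (.of_wp trivial (by decide) (by simp [Program.wp, NExp.eval]; omega)) ?_ (by omega)
  rintro m₁ hf₁ rfl
  refine Runs.seq (runs_maxLoop (N := 2 * n)
    (g := fun e => min (m.nat f e) (m.nat f (mate e))) (M := 2 * n * 52 + 11)
    (by simpa using hN) (by omega) ?_ (by simp) ?_ ?_)
    (U := 2 * n * (2 * ix.cost + 50) + 16) ?_ ?_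
  · intro k hk
    have := hF k hk
    omega
  · intro k hk m' hf' hkm
    have : m'.nat f = m.nat f := by
      rw [hf'.2 f (by simp [hf1, hf2]), Memory.nat_setNat_of_ne _ _ _ _ _ hf2]
    simp [NExp.eval, hkm, this]
  · simp [NExp.cost, minExp, mateExp]; omega
  · intro m₂ hf₂ hm₂
    have hff : m₂.nat f = m.nat f := by
      rw [hf₂.2 f (by simp [maxLoop, forLoop, Program.writes, hf1, hf2]),
        Memory.nat_setNat_of_ne _ _ _ _ _ hf2]
    have hN₂ : m₂.nat nPoints 0 = 2 * n := by
      rw [hf₂.2 _ (by simp [maxLoop, forLoop, Program.writes])]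
      simpa using hN
    have hF₂ : Frame [counter, maxVar, out] m m₂ :=
      (hf₁.mono (by simp [Program.writes])).trans
        (hf₂.mono (by simp [maxLoop, forLoop, Program.writes]))
    refine (Runs.forLoop (N := 2 * n) (T := 2 * ix.cost + 36) (fun k m' =>
      m'.nat maxVar 0 = reach (2 * n) P (m.nat f) k ∧
      ∀ a < k, m'.nat out a = reach (2 * n) P (m.nat f) a) ?_ ?_ hN₂ (by omega) ?_ ?_ ?_).mono
      le_rfl (fun _ _ h => h.2)
    · simp [Program.writes]; omega
    · simp [Program.writes]; omega
    · simp [hm₂, reach]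
    · rintro k m' hk hf' hkm ⟨hI₁, hI₂⟩
      have hf'' : Frame [counter, maxVar, out] m m' :=
        hF₂.trans (hf'.mono (by simp [Program.writes]))
      have hfm : m'.nat f = m.nat f := hf''.2 f (by simp [hf1, hf2, hf3])
      have h₁ := hix k hk m' hf'' hkm
      -- The index is evaluated after the write to `out`, which is why `hix` must tolerate changes
      -- of `out`.
      have h₂ : ix.eval (m'.setNat out k (m'.nat maxVar 0)) = P k :=
        hix k hk _ (hf''.trans (Frame.setNat _ _ _ (by simp)))
          (by rw [Memory.nat_setNat_of_ne _ _ _ _ _ (Ne.symm ho2), hkm])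
      have hlt : reach (2 * n) P (m.nat f) k < 2 * n := reach_lt (by omega) hP hF hk.le
      have hlt' := hF _ (mate_lt (hP k hk))
      refine .of_wp ⟨trivial, trivial⟩
        (by simp [Program.time, NExp.cost, maxExp, mateExp]; omega) ?_
      simp only [Program.wp, NExp.eval, maxExp_eval, mateExp_eval, hkm, hI₁] at h₂ ⊢
      have e1 : (m'.setNat out k (reach (2 * n) P (m.nat f) k)).nat maxVar 0 =
          reach (2 * n) P (m.nat f) k := by
        rw [Memory.nat_setNat_of_ne _ _ _ _ _ (Ne.symm ho3), hI₁]
      have e2 : (m'.setNat out k (reach (2 * n) P (m.nat f) k)).nat f = m.nat f := by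
        rw [Memory.nat_setNat_of_ne _ _ _ _ _ hf3, hfm]
      rw [h₂, e1, e2]
      refine ⟨by omega, by omega, ?_, ?_⟩
      · rw [Memory.nat_setNat_of_ne _ _ _ _ _ (by decide), Memory.nat_setNat_self]
        simp [reach, Finset.range_add_one, max_comm, max_left_comm]
      · intro a ha
        rw [Memory.nat_setNat_of_ne _ _ _ _ _ ho2, Memory.nat_setNat_of_ne _ _ _ _ _ ho3,
          Memory.nat_setNat_self]
        obtain rfl | hlt := Nat.eq_or_lt_of_le (Nat.le_of_lt_succ ha)
        · simp
        · simpa [Function.update_apply, hlt.ne] using hI₂ a hlt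
    · have : 2 * ix.cost + 36 + 14 = 2 * ix.cost + 50 := rfl
      rw [this]
      omega
  · have h : 2 * n * (2 * ix.cost + 120) = 2 * n * (2 * ix.cost + 50) + 2 * n * 70 := by ring
    omega

/-- Compute `slack`. -/
def slackProgram : Program :=
  .seq (assign maxVar (.const 0))
    (.seq (maxLoop (.sub (var nPoints)
        (maxExp (.read rankX (var counter)) (.read rankX (mateExp (var counter))))))
      (assign slackVar (var maxVar)))

theorem runs_slackProgram {n W : ℕ} {m : Memory}
    (hN : m.nat nPoints 0 = 2 * n) (hW : 4 * n + 1 < W) :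
    Runs W slackProgram m (200 * n + 30) fun m' =>
      m'.nat slackVar 0 = slack (2 * n) (m.nat rankX) := by
  refine Runs.seq (T := 3) (U := 200 * n + 27)
    (Q := fun m' => m' = m.setNat maxVar 0 0)
    (.of_wp trivial (by decide) (by simp [Program.wp, NExp.eval]; omega)) ?_ (by omega)
  rintro m₁ hf₁ rfl
  refine Runs.seq (runs_maxLoop (N := 2 * n)
    (g := fun e => 2 * n - max (m.nat rankX e) (m.nat rankX (mate e))) (M := 2 * n * 100 + 11)
    (by simpa using hN) (by omega) (fun _ _ => Nat.sub_le _ _) (by simp) ?_ ?_)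
    (U := 10) ?_ (by omega)
  · intro k hk m' hf' hkm
    have h1 : m'.nat rankX = m.nat rankX := by
      rw [hf'.2 _ (by decide), Memory.nat_setNat_of_ne _ _ _ _ _ (by decide)]
    have h2 : m'.nat nPoints 0 = 2 * n := by
      rw [hf'.2 _ (by decide), Memory.nat_setNat_of_ne _ _ _ _ _ (by decide), hN]
    simp [NExp.eval, hkm, h1, h2]
  · simp [NExp.cost, maxExp, mateExp]; omega
  · intro m₂ hf₂ hm₂
    refine .of_wp trivial (by decide) ?_
    have : (range (2 * n)).sup (fun e => 2 * n - max (m.nat rankX e) (m.nat rankX (mate e))) ≤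
        2 * n := Finset.sup_le fun _ _ => Nat.sub_le _ _
    simp only [Program.wp, NExp.eval, hm₂]
    exact ⟨by omega, by simp [slack]⟩


/-- The memory holds the numbers of segments and endpoints and the two rankings. -/
structure Loaded (n : ℕ) (P Q X Y : ℕ → ℕ) (m : Memory) : Prop where
  segments : m.nat nSegments 0 = n
  points : m.nat nPoints 0 = 2 * n
  perm_eq : m.nat perm = P
  permY_eq : m.nat permY = Q
  rankX_eq : m.nat rankX = X
  rankY_eq : m.nat rankY = Y

theorem Loaded.frame {n : ℕ} {P Q X Y : ℕ → ℕ} {m m' : Memory} {l : List ℕ}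
    (h : Loaded n P Q X Y m) (hf : Frame l m m')
    (hl : ∀ a ∈ [nSegments, nPoints, perm, permY, rankX, rankY], a ∉ l) :
    Loaded n P Q X Y m' := by
  obtain ⟨h1, h2, h3, h4, h5, h6⟩ := h
  refine ⟨?_, ?_, ?_, ?_, ?_, ?_⟩ <;> rw [hf.2 _ (hl _ (by simp))] <;> assumption

/-- Combine the two lower bounds for the right side. -/
def targetProgram : Program :=
  forLoop counter nPoints
    (.store rightArr (var counter) (maxExp (.read rightArr (var counter))
      (.read reachArr
        (.sub (.sub (var nPoints) (.const 1)) (.read topArr (var counter))))))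

/-- Compute the arrays `topOf` and `rightOf` and the number `slack`. -/
def prepareProgram : Program :=
  .seq (reachProgram rankY topArr (.read perm (var counter)))
    (.seq (reachProgram rankX rightArr (.read perm (var counter)))
      (.seq (reachProgram rankX reachArr
          (.read permY (.sub (.sub (var nPoints) (.const 1)) (var counter))))
        (.seq targetProgram slackProgram)))

section

variable {n W : ℕ} {P Q X Y : ℕ → ℕ} {m : Memory}

theorem runs_targetProgram (h : Loaded n P Q X Y m) (hP : Ranking (2 * n) P X)
    (hQ : Ranking (2 * n) Q Y) (hW : 4 * n + 1 < W)
    (h₁ : ∀ a < 2 * n, m.nat topArr a = topOf (2 * n) P Y a)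
    (h₂ : ∀ a < 2 * n, m.nat rightArr a = reach (2 * n) P X a)
    (h₃ : ∀ a < 2 * n, m.nat reachArr a = reach (2 * n) (rev (2 * n) Q) X a) :
    Runs W targetProgram m (200 * n + 11) fun m' =>
      ∀ a < 2 * n, m'.nat rightArr a = rightOf (2 * n) P Q X Y a := by
  refine (Runs.forLoop (N := 2 * n) (T := 50) (fun k m' => ∀ a < 2 * n, m'.nat rightArr a =
    if a < k then rightOf (2 * n) P Q X Y a else reach (2 * n) P X a) (by decide) (by decide)
    h.points (by omega) ?_ ?_ (by omega)).mono le_rfl ?_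
  · intro a ha
    simpa using h₂ a ha
  · intro k m' hk hf hkm hI
    have hl := h.frame hf (by decide)
    have e1 : m'.nat topArr = m.nat topArr := hf.2 _ (by decide)
    have e2 : m'.nat reachArr = m.nat reachArr := hf.2 _ (by decide)
    have e3 := rightOf_lt hP hQ hk
    have e4 := hI k hk
    rw [if_neg (lt_irrefl k)] at e4
    have e5 : max (reach (2 * n) P X k) (reach (2 * n) (rev (2 * n) Q) X
      (2 * n - 1 - topOf (2 * n) P Y k)) = rightOf (2 * n) P Q X Y k := rfl
    refine .of_wp trivial (by decide) ?_
    simp only [Program.wp, NExp.eval, maxExp_eval, hkm, hl.points, e1, e2, h₁ k hk, e4]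
    rw [h₃ _ (by omega), e5]
    refine ⟨by omega, fun a ha => ?_⟩
    by_cases hak : a = k
    · subst hak; simp
    · have := hI a ha
      have hlt : a < k + 1 ↔ a < k := by omega
      simpa [hak, hlt] using this
  · intro m' _ hI a ha
    rw [hI a ha, if_pos ha]

theorem runs_prepareProgram (h : Loaded n P Q X Y m) (hP : Ranking (2 * n) P X)
    (hQ : Ranking (2 * n) Q Y) (hW : 4 * n + 1 < W) :
    Runs W prepareProgram m (1400 * n + 200) fun m' =>
      (∀ a < 2 * n, m'.nat topArr a = topOf (2 * n) P Y a) ∧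
      (∀ a < 2 * n, m'.nat rightArr a = rightOf (2 * n) P Q X Y a) ∧
      m'.nat slackVar 0 = slack (2 * n) X := by
  refine Runs.seq (runs_reachProgram (P := P) (M := 300 * n + 30) h.points hW (by decide)
    (by decide) hP.lt (by rw [h.rankY_eq]; exact hQ.rank_lt) ?_ (by simp [NExp.cost]; omega))
    (U := 1100 * n + 170) ?_ (by omega)
  · intro k hk m' hf hkm
    simp [NExp.eval, hkm, (h.frame hf (by decide)).perm_eq]
  intro m₁ hf₁ hm₁
  have h₁ := h.frame hf₁ (by decide)
  rw [h.rankY_eq] at hm₁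
  refine Runs.seq (runs_reachProgram (P := P) (M := 300 * n + 30) h₁.points hW (by decide)
    (by decide) hP.lt (by rw [h₁.rankX_eq]; exact hP.rank_lt) ?_ (by simp [NExp.cost]; omega))
    (U := 800 * n + 140) ?_ (by omega)
  · intro k hk m' hf hkm
    simp [NExp.eval, hkm, (h₁.frame hf (by decide)).perm_eq]
  intro m₂ hf₂ hm₂
  have h₂ := h₁.frame hf₂ (by decide)
  rw [h₁.rankX_eq] at hm₂
  refine Runs.seq (runs_reachProgram (P := rev (2 * n) Q) (M := 300 * n + 30) h₂.points hW
    (by decide) (by decide) hQ.rev.lt (by rw [h₂.rankX_eq]; exact hP.rank_lt) ?_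
    (by simp [NExp.cost]; omega)) (U := 500 * n + 110) ?_ (by omega)
  · intro k hk m' hf hkm
    have := h₂.frame hf (by decide)
    simp [NExp.eval, hkm, this.permY_eq, this.points, rev]
  intro m₃ hf₃ hm₃
  have h₃ := h₂.frame hf₃ (by decide)
  rw [h₂.rankX_eq] at hm₃
  have htop : m₃.nat topArr = m₁.nat topArr := by
    rw [hf₃.2 _ (by decide), hf₂.2 _ (by decide)]
  have hright : m₃.nat rightArr = m₂.nat rightArr := hf₃.2 _ (by decide)
  refine Runs.seq (runs_targetProgram h₃ hP hQ hW (by rw [htop]; exact hm₁)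
    (by rw [hright]; exact hm₂) hm₃) (U := 300 * n + 90) ?_ (by omega)
  intro m₄ hf₄ hm₄
  have h₄ := h₃.frame hf₄ (by decide)
  refine (runs_slackProgram h₄.points hW).mono (by omega) ?_
  intro m₅ hf₅ hm₅
  rw [h₄.rankX_eq] at hm₅
  refine ⟨?_, ?_, hm₅⟩
  · rw [hf₅.2 _ (by decide), hf₄.2 _ (by decide), htop]; exact hm₁
  · rw [hf₅.2 _ (by decide)]; exact hm₄

end

/-! ### The sweep program. -/

/-- Increment the count if the test succeeds. -/
def countIf (t : Test) : Program :=
  .branch t (assign sweepCount (.add (var sweepCount) (.const 1))) .skip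

/-- Decrement the count if the test succeeds. -/
def discountIf (t : Test) : Program :=
  .branch t (assign sweepCount (.sub (var sweepCount) (.const 1))) .skip

/-- The top side that belongs to the current left side. -/
def topGoal : NExp := .read topArr (var sweepLeft)

/-- The right side that belongs to the current left side. -/
def rightGoal : NExp := .read rightArr (var sweepLeft)

/-- Raise the top of the current box. -/
def raiseTop : Program :=
  .seq (countIf (.and (.natLE (var sweepLeft) (.read rankX (.read permY (var sweepTop))))
      (ltTest (.read rankX (.read permY (var sweepTop))) (var sweepRight))))
    (assign sweepTop (.add (var sweepTop) (.const 1)))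

/-- Move the right side of the current box to the right. -/
def moveRight : Program :=
  .seq (countIf (.and (.natLE (var sweepLeft) (var sweepRight))
      (ltTest (.read rankY (.read perm (var sweepRight))) (var sweepTop))))
    (assign sweepRight (.add (var sweepRight) (.const 1)))

/-- Move the right side of the current box to the left. -/
def moveLeft : Program :=
  .seq (assign sweepRight (.sub (var sweepRight) (.const 1)))
    (discountIf (.and (.natLE (var sweepLeft) (var sweepRight))
      (ltTest (.read rankY (.read perm (var sweepRight))) (var sweepTop))))

/-- The test whether the current box is a stabbing rectangle with a point on each side. -/
def acceptTest : Test :=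
  .and (.natLE (.add (var sweepLeft) (var slackVar)) (var nPoints))
    (.and (.and (.natLE (var sweepCount) (var nSegments)) (.natLE (var nSegments) (var sweepCount)))
      (.and (.and (.natLE (var sweepLeft) rightGoal)
          (.natLE (.read rankY (.read perm (var sweepLeft))) topGoal))
        (.and (.natLE (.read rankY (.read perm rightGoal)) topGoal)
          (.and (.natLE (var sweepLeft) (.read rankX (.read permY topGoal)))
            (.natLE (.read rankX (.read permY topGoal)) rightGoal)))))

/-- Record the result for the current left side and move on to the next one. -/
def nextLeft : Program :=
  .seq (.branch acceptTest
      (.store resultArr (var sweepLeft) (.add rightGoal (.const 1)))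
      (.store resultArr (var sweepLeft) (.const 0)))
    (.seq (discountIf (.and (ltTest (var sweepLeft) (var sweepRight))
        (ltTest (.read rankY (.read perm (var sweepLeft))) (var sweepTop))))
      (assign sweepLeft (.add (var sweepLeft) (.const 1))))

/-- One step of the sweep. -/
def sweepStep : Program :=
  .branch (.natLE (var sweepTop) topGoal) raiseTop
    (.branch (.natLE (var sweepRight) rightGoal) moveRight
      (.branch (ltTest (.add rightGoal (.const 1)) (var sweepRight)) moveLeft nextLeft))

/-- For each left side `a`, store in `resultArr` the number `rightOf a + 1` if the rectangle with
sides `a`, `rightOf a`, `topOf a` is stabbing and has a point on each side, and `0` otherwise. -/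
def sweepProgram : Program :=
  .seq prepareProgram
    (.seq (.seq (assign sweepLeft (.const 0)) (.seq (assign sweepRight (.const 0))
        (.seq (assign sweepTop (.const 0)) (assign sweepCount (.const 0)))))
      (.loop (ltTest (var sweepLeft) (var nPoints)) sweepStep))

section

variable {n W : ℕ} {P Q X Y : ℕ → ℕ} {m : Memory}

/-- The invariant of the sweep. -/
structure SweepInv (n : ℕ) (P Q X Y : ℕ → ℕ) (m : Memory) : Prop where
  loaded : Loaded n P Q X Y m
  top : ∀ a < 2 * n, m.nat topArr a = topOf (2 * n) P Y a
  right : ∀ a < 2 * n, m.nat rightArr a = rightOf (2 * n) P Q X Y a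
  slack : m.nat slackVar 0 = slack (2 * n) X
  state : SweepState n P Q X Y (m.nat sweepLeft 0) (m.nat sweepRight 0) (m.nat sweepTop 0)
    (m.nat sweepCount 0) (m.nat resultArr)

/-- The measure of the sweep. -/
def memMeasure (n : ℕ) (P Q X Y : ℕ → ℕ) (m : Memory) : ℕ :=
  sweepMeasure (2 * n) P Q X Y (m.nat sweepLeft 0) (m.nat sweepRight 0) (m.nat sweepTop 0)

theorem SweepInv.frame {m' : Memory} (h : SweepInv n P Q X Y m)
    (hf : Frame [resultArr, sweepLeft, sweepRight, sweepTop, sweepCount] m m')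
    (hs : SweepState n P Q X Y (m'.nat sweepLeft 0) (m'.nat sweepRight 0) (m'.nat sweepTop 0)
      (m'.nat sweepCount 0) (m'.nat resultArr)) : SweepInv n P Q X Y m' := by
  refine ⟨h.loaded.frame hf (by decide), ?_, ?_, ?_, hs⟩ <;> rw [hf.2 _ (by decide)]
  exacts [h.top, h.right, h.slack]

/-- The four branches are `SweepState.top_succ`, `right_succ`, `right_pred` and `left_succ`. -/
theorem runs_sweepStep (hP : Ranking (2 * n) P X) (hQ : Ranking (2 * n) Q Y) (hW : 4 * n + 1 < W)
    (h : SweepInv n P Q X Y m) (ha : m.nat sweepLeft 0 < 2 * n) :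
    Runs W sweepStep m 300 fun m' =>
      SweepInv n P Q X Y m' ∧ memMeasure n P Q X Y m' < memMeasure n P Q X Y m := by
  suffices H : sweepStep.wp W (fun m' => SweepState n P Q X Y (m'.nat sweepLeft 0)
      (m'.nat sweepRight 0) (m'.nat sweepTop 0) (m'.nat sweepCount 0) (m'.nat resultArr) ∧
      memMeasure n P Q X Y m' < memMeasure n P Q X Y m) m from
    (Runs.of_wp (by simp [sweepStep, Program.NatOnly, raiseTop, moveRight, moveLeft, nextLeft,
      countIf, discountIf]) (by decide) H).mono le_rfl
        fun m' hf hm' => ⟨h.frame (hf.mono (by decide)) hm'.1, hm'.2⟩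
  obtain ⟨⟨k1, k2, k3, k4, k5, k6⟩, htop, hright, hslack, hs⟩ := h
  have g1 := htop _ ha
  have g2 := hright _ ha
  have g3 := hs.count
  -- A count of at most `2 * n` keeps the stored word below `W`.
  have g4 := boxCount_le (N := 2 * n) (X := X) (Y := Y) (a := m.nat sweepLeft 0)
    (b := m.nat sweepRight 0) (c := m.nat sweepTop 0)
  rw [← g3] at g4
  have g5 := hs.right_le
  have g6 := hs.top_le
  have g7 := rightOf_lt hP hQ ha
  have hsucc := fun hc => hs.top_succ hP hQ ha hc
  have hright' := fun hb => hs.right_succ hP hQ ha hb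
  have hleft := fun hb => hs.right_pred (P := P) (Q := Q) hP hb
  simp only [memMeasure, sweepStep, Program.wp]
  refine ⟨fun h1 => ?_, fun h1 => ⟨fun h2 => ?_, fun h2 => ⟨fun h3 => ?_, fun h3 => ?_⟩⟩⟩
  · simp only [topGoal, Test.Holds, NExp.eval, g1] at h1
    have := hsucc h1
    simp only [raiseTop, countIf, Program.wp, Test.Holds, NExp.eval, k4, k5]
    refine ⟨fun h2 => ⟨by omega, ?_⟩, fun h2 => ⟨by omega, ?_⟩⟩
    · rw [if_pos ⟨h2.1, h2.2⟩] at this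
      simpa using ⟨by omega, this⟩
    · rw [if_neg (fun h => h2 ⟨h.1, h.2⟩)] at this
      simpa using this
  · simp only [rightGoal, Test.Holds, NExp.eval, g2] at h2
    have := hright' h2
    simp only [moveRight, countIf, Program.wp, Test.Holds, NExp.eval, k3, k6]
    refine ⟨fun h2 => ⟨by omega, ?_⟩, fun h2 => ⟨by omega, ?_⟩⟩
    · rw [if_pos ⟨h2.1, h2.2⟩] at this
      simpa using ⟨by omega, this⟩
    · rw [if_neg (fun h => h2 ⟨h.1, h.2⟩)] at this
      simpa using this
  · simp only [rightGoal, Test.Holds, NExp.eval, g2] at h3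
    have := hleft h3
    simp only [moveLeft, discountIf, Program.wp, Test.Holds, NExp.eval]
    simp only [Memory.nat_setNat_of_ne, Memory.nat_setNat_self, ne_eq, Nat.reduceEqDiff,
      not_false_eq_true, Function.update_self, k3, k6]
    refine ⟨by omega, fun h2 => ⟨by omega, ?_⟩, fun h2 => ?_⟩
    · rw [if_pos ⟨h2.1, h2.2⟩] at this
      simpa using this
    · rw [if_neg (fun h => h2 ⟨h.1, h.2⟩)] at this
      simpa using this
  · simp only [topGoal, rightGoal, Test.Holds, NExp.eval, g1, g2] at h1 h2 h3
    have hb : m.nat sweepRight 0 = rightOf (2 * n) P Q X Y (m.nat sweepLeft 0) + 1 := by omega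
    have hacc := hs.accepts_iff hP hQ ha hb (by omega)
    -- Both outcomes of the test continue with the same code; `r` stands for the recorded result.
    have key : ∀ r, (Accepts n P Q X Y (m.nat sweepLeft 0) →
        r = rightOf (2 * n) P Q X Y (m.nat sweepLeft 0) + 1) →
        (¬ Accepts n P Q X Y (m.nat sweepLeft 0) → r = 0) → r < W →
        Program.wp W (.seq (discountIf (.and (ltTest (var sweepLeft) (var sweepRight))
          (ltTest (.read rankY (.read perm (var sweepLeft))) (var sweepTop))))
          (assign sweepLeft (.add (var sweepLeft) (.const 1)))) (fun m' =>
          SweepState n P Q X Y (m'.nat sweepLeft 0)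
          (m'.nat sweepRight 0) (m'.nat sweepTop 0) (m'.nat sweepCount 0) (m'.nat resultArr) ∧
          sweepMeasure (2 * n) P Q X Y (m'.nat sweepLeft 0) (m'.nat sweepRight 0)
            (m'.nat sweepTop 0) < sweepMeasure (2 * n) P Q X Y (m.nat sweepLeft 0)
            (m.nat sweepRight 0) (m.nat sweepTop 0))
          (m.setNat resultArr (m.nat sweepLeft 0) r) := by
      intro r hr1 hr2 hr
      have := hs.left_succ (R' := Function.update (m.nat resultArr) (m.nat sweepLeft 0) r) hP ha hb
        (fun j hj => by simp [hj.ne]) (by simpa using hr1)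
        (by simpa using hr2)
      simp only [discountIf, Program.wp, Test.Holds, NExp.eval]
      simp only [Memory.nat_setNat_of_ne, Memory.nat_setNat_self, ne_eq, Nat.reduceEqDiff,
        not_false_eq_true, k3, k6]
      refine ⟨fun h2 => ⟨by omega, ?_⟩, fun h2 => ⟨by omega, ?_⟩⟩
      · rw [if_pos ⟨h2.1, h2.2⟩] at this
        simpa using ⟨by omega, this⟩
      · rw [if_neg (fun h => h2 ⟨h.1, h.2⟩)] at this
        simpa using this
    have htest : acceptTest.Holds m ↔ Accepts n P Q X Y (m.nat sweepLeft 0) := by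
      rw [hacc]
      simp only [acceptTest, topGoal, rightGoal, Test.Holds, NExp.eval, g1, g2, k1, k2, k3, k4, k5,
        k6, hslack]
    simp only [nextLeft, Program.wp, htest, NExp.eval]
    simp only [Program.wp] at key
    refine ⟨fun h => ?_, fun h => ?_⟩
    · have h7 : NExp.eval m rightGoal = rightOf (2 * n) P Q X Y (m.nat sweepLeft 0) := by
        simp only [rightGoal, NExp.eval, g2]
      rw [h7]
      exact ⟨by omega, key _ (fun _ => rfl) (fun h' => absurd h h') (by omega)⟩
    · exact ⟨by omega, key _ (fun h' => absurd h' h) (fun _ => rfl) (by omega)⟩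

theorem runs_sweepProgram (h : Loaded n P Q X Y m) (hP : Ranking (2 * n) P X)
    (hQ : Ranking (2 * n) Q Y) (hn : 0 < n) (hW : 4 * n + 1 < W) :
    Runs W sweepProgram m (6000 * n + 1000) fun m' =>
      (∀ a < 2 * n, m'.nat topArr a = topOf (2 * n) P Y a) ∧
      (∀ a < 2 * n, Accepts n P Q X Y a →
        m'.nat resultArr a = rightOf (2 * n) P Q X Y a + 1) ∧
      ∀ a < 2 * n, ¬ Accepts n P Q X Y a → m'.nat resultArr a = 0 := by
  refine Runs.seq (runs_prepareProgram h hP hQ hW) (U := 4600 * n + 800) ?_ (by omega)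
  rintro m₁ hf₁ ⟨h1, h2, h3⟩
  have hl₁ := h.frame hf₁ (by decide)
  refine Runs.seq (T := 12) (U := 4600 * n + 788) (Q := SweepInv n P Q X Y) ?_ ?_ (by omega)
  · refine (Runs.of_wp (Q := fun m' => m'.nat sweepLeft 0 = 0 ∧ m'.nat sweepRight 0 = 0 ∧
      m'.nat sweepTop 0 = 0 ∧ m'.nat sweepCount 0 = 0) (by simp [Program.NatOnly]) (by decide)
      (by simp [Program.wp, NExp.eval]; omega)).mono le_rfl ?_
    rintro m' hf ⟨e1, e2, e3, e4⟩
    refine ⟨hl₁.frame hf (by decide), ?_, ?_, ?_, ?_⟩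
    · rw [hf.2 _ (by decide)]; exact h1
    · rw [hf.2 _ (by decide)]; exact h2
    · rw [hf.2 _ (by decide)]; exact h3
    · rw [e1, e2, e3, e4]; exact SweepState.zero
  · intro m₂ hf₂ hI
    refine (Runs.loop (T := 300) (SweepInv n P Q X Y) (memMeasure n P Q X Y) hI ?_ ?_).mono
      le_rfl ?_
    · intro m₃ _ hI₃ hlt
      refine runs_sweepStep hP hQ hW hI₃ ?_
      simpa [Test.Holds, NExp.eval, hI₃.loaded.points] using hlt
    · have hμ : memMeasure n P Q X Y m₂ ≤ 14 * n := by
        have h4 := hI.state.left_le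
        have h5 := hI.state.right_le
        have h6 : rightOf (2 * n) P Q X Y (m₂.nat sweepLeft 0) ≤ 2 * n :=
          max_le (reach_lt hn hP.lt hP.rank_lt h4).le
            (reach_lt hn hQ.rev.lt hP.rank_lt (by omega)).le
        have h7 := reach_lt (a := 2 * n - 1 - topOf (2 * n) P Y (m₂.nat sweepLeft 0)) hn
          hQ.rev.lt hP.rank_lt (by omega)
        unfold memMeasure sweepMeasure
        omega
      simp only [Test.cost, NExp.cost]
      omega
    · rintro m₃ _ ⟨⟨hl, h4, -, -, hs⟩, hlt⟩
      have ha : m₃.nat sweepLeft 0 = 2 * n := by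
        have := hs.left_le
        simp [Test.Holds, NExp.eval, hl.points] at hlt
        omega
      have h5 := hs.accept
      have h6 := hs.reject
      rw [ha] at h5 h6
      exact ⟨h4, h5, h6⟩

end

/-! ### Rectangles in the plane and in rank space -/

/-- The rectangle with sides through `P a`, `P b` and `Q c` contains no point that ties with one of
these points and is outside the rectangle in rank space. -/
def NoTies (N : ℕ) (P Q : ℕ → ℕ) (x y : ℕ → ℝ) (a b c : ℕ) : Prop :=
  ¬ (1 ≤ a ∧ x (P a) ≤ x (P (a - 1))) ∧
  ¬ (b + 2 ≤ N ∧ x (P (b + 1)) ≤ x (P b) ∧ y (P (b + 1)) ≤ y (Q c)) ∧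
  ¬ (c + 2 ≤ N ∧ y (Q (c + 1)) ≤ y (Q c) ∧ x (P a) ≤ x (Q (c + 1)) ∧ x (Q (c + 1)) ≤ x (P b))

theorem lexLE_of_rank_le {N : ℕ} {P X : ℕ → ℕ} {x y : ℕ → ℝ} (hs : SortedPerm (LexLE x y) N P)
    (hP : Ranking N P X) {e f : ℕ} (he : e < N) (hf : f < N) (h : X e ≤ X f) : LexLE x y e f := by
  have := hs.sorted (X e) (X f) h (hP.rank_lt f hf)
  rwa [hP.apply_rank e he, hP.apply_rank f hf] at this

section

variable {n a b c : ℕ} {P Q X Y : ℕ → ℕ} {x y : ℕ → ℝ}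

theorem inside_imp (hsP : SortedPerm (LexLE x y) (2 * n) P) (hP : Ranking (2 * n) P X)
    (hsQ : SortedPerm (LexLE y x) (2 * n) Q) (hQ : Ranking (2 * n) Q Y)
    (h : RankStabber (2 * n) P Q X Y a b c) {e : ℕ} (he : e < 2 * n) (hin : Inside X Y a b c e) :
    x (P a) ≤ x e ∧ x e ≤ x (P b) ∧ y e ≤ y (Q c) := by
  refine ⟨(lexLE_of_rank_le hsP hP (hP.lt a h.left_lt) he ?_).le,
    (lexLE_of_rank_le hsP hP he (hP.lt b h.right_lt) ?_).le,
    (lexLE_of_rank_le hsQ hQ he (hQ.lt c h.top_lt) ?_).le⟩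
  · rw [hP.rank a h.left_lt]; exact hin.1
  · rw [hP.rank b h.right_lt]; exact hin.2.1
  · rw [hQ.rank c h.top_lt]; exact hin.2.2

/-- A point in the plane rectangle but outside the rank box ties with a side, and by sortedness so
does the next point beyond that side. On the left, the lexicographic order places the tied neighbour
no higher than `P a`, so its `x` alone decides. On the right, the neighbour is a lowest one among
the excluded ties, and at the top it is a leftmost one, so if it misses the rectangle then all of
them do. -/
theorem noTies_iff (hsP : SortedPerm (LexLE x y) (2 * n) P) (hP : Ranking (2 * n) P X)
    (hsQ : SortedPerm (LexLE y x) (2 * n) Q) (hQ : Ranking (2 * n) Q Y)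
    (h : RankStabber (2 * n) P Q X Y a b c) :
    NoTies (2 * n) P Q x y a b c ↔ ∀ e < 2 * n,
      (x (P a) ≤ x e ∧ x e ≤ x (P b) ∧ y e ≤ y (Q c)) → Inside X Y a b c e := by
  have ha := h.left_lt
  have hb := h.right_lt
  have hc := h.top_lt
  have hPa := hP.lt a ha
  have hPb := hP.lt b hb
  have hQc := hQ.lt c hc
  obtain ⟨la, lb, lc⟩ := inside_imp hsP hP hsQ hQ h hPa h.left
  obtain ⟨ra, rb, rc⟩ := inside_imp hsP hP hsQ hQ h hPb h.right
  obtain ⟨ta, tb, tc⟩ := inside_imp hsP hP hsQ hQ h hQc h.top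
  constructor
  · rintro ⟨h1, h2, h3⟩ e he ⟨hx, hx', hy⟩
    refine ⟨?_, ?_, ?_⟩
    · by_contra hlt
      have hm := hP.lt (a - 1) (by omega)
      have := lexLE_of_rank_le hsP hP he hm (by rw [hP.rank _ (by omega)]; omega)
      exact h1 ⟨by omega, hx.trans this.le⟩
    · by_contra hlt
      have hXe := hP.rank_lt e he
      have hm := hP.lt (b + 1) (by omega)
      have h4 := lexLE_of_rank_le hsP hP hm he (by rw [hP.rank _ (by omega)]; omega)
      have h5 := lexLE_of_rank_le hsP hP hPb hm (by rw [hP.rank _ hb, hP.rank _ (by omega)]; omega)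
      have h6 := h4.le
      have h7 := h5.le
      have h8 := (h4 (by linarith)).2
      exact h2 ⟨by omega, by linarith, by linarith⟩
    · by_contra hlt
      have hYe := hQ.rank_lt e he
      have hm := hQ.lt (c + 1) (by omega)
      have h4 := lexLE_of_rank_le hsQ hQ hm he (by rw [hQ.rank _ (by omega)]; omega)
      have h5 := lexLE_of_rank_le hsQ hQ hQc hm (by rw [hQ.rank _ hc, hQ.rank _ (by omega)]; omega)
      have h6 := h4.le
      have h7 := h5.le
      have h8 := (h4 (by linarith)).2
      have h9 := (h5 (by linarith)).2
      exact h3 ⟨by omega, by linarith, by linarith, by linarith⟩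
  · intro H
    refine ⟨?_, ?_, ?_⟩
    · rintro ⟨h1, h2⟩
      have hm := hP.lt (a - 1) (by omega)
      have h5 := lexLE_of_rank_le hsP hP hm hPa (by rw [hP.rank _ (by omega), hP.rank _ ha]; omega)
      have h6 := h5.le
      have h7 := (h5 h2).2
      have := (H _ hm ⟨h2, by linarith, by linarith⟩).1
      rw [hP.rank _ (by omega)] at this
      omega
    · rintro ⟨h1, h2, h3⟩
      have hm := hP.lt (b + 1) (by omega)
      have h5 := lexLE_of_rank_le hsP hP hPb hm (by rw [hP.rank _ hb, hP.rank _ (by omega)]; omega)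
      have h6 := h5.le
      have := (H _ hm ⟨by linarith, h2, h3⟩).2.1
      rw [hP.rank _ (by omega)] at this
      omega
    · rintro ⟨h1, h2, h3, h4⟩
      have hm := hQ.lt (c + 1) (by omega)
      have := (H _ hm ⟨h3, h4, h2⟩).2.2
      rw [hQ.rank _ (by omega)] at this
      omega

/-- Each side of a box carries a contained point, so equal contents bound the sides of each box by
those of the other. Distinct triples thus give inequivalent rectangles. -/
theorem RankStabber.eq_of_inside_iff {a' b' c' : ℕ} (h : RankStabber (2 * n) P Q X Y a b c)
    (h' : RankStabber (2 * n) P Q X Y a' b' c') (hP : Ranking (2 * n) P X)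
    (hQ : Ranking (2 * n) Q Y)
    (hin : ∀ e < 2 * n, Inside X Y a b c e ↔ Inside X Y a' b' c' e) :
    (a, b, c) = (a', b', c') := by
  have h1 := (hin _ (hP.lt a h.left_lt)).1 h.left
  have h2 := (hin _ (hP.lt b h.right_lt)).1 h.right
  have h3 := (hin _ (hQ.lt c h.top_lt)).1 h.top
  have h4 := (hin _ (hP.lt a' h'.left_lt)).2 h'.left
  have h5 := (hin _ (hP.lt b' h'.right_lt)).2 h'.right
  have h6 := (hin _ (hQ.lt c' h'.top_lt)).2 h'.top
  unfold Inside at *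
  rw [hP.rank a h.left_lt] at h1
  rw [hP.rank b h.right_lt] at h2
  rw [hQ.rank c h.top_lt] at h3
  rw [hP.rank a' h'.left_lt] at h4
  rw [hP.rank b' h'.right_lt] at h5
  rw [hQ.rank c' h'.top_lt] at h6
  simp only [Prod.mk.injEq]
  omega

/-- Each stabbing rectangle corresponds to one in rank space. -/
theorem exists_rankStabber (hsP : SortedPerm (LexLE x y) (2 * n) P) (hP : Ranking (2 * n) P X)
    (hsQ : SortedPerm (LexLE y x) (2 * n) Q) (hQ : Ranking (2 * n) Q Y) (hn : 0 < n)
    {α β γ : ℝ} (hst : ∀ e < 2 * n, (α ≤ x e ∧ x e ≤ β ∧ y e ≤ γ) ↔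
      ¬ (α ≤ x (mate e) ∧ x (mate e) ≤ β ∧ y (mate e) ≤ γ)) :
    ∃ a b c, RankStabber (2 * n) P Q X Y a b c ∧ NoTies (2 * n) P Q x y a b c ∧
      ∀ e < 2 * n, (α ≤ x e ∧ x e ≤ β ∧ y e ≤ γ) ↔ Inside X Y a b c e := by
  classical
  let D : Finset ℕ := {e ∈ range (2 * n) | α ≤ x e ∧ x e ≤ β ∧ y e ≤ γ}
  have hD : ∀ e, e ∈ D ↔ e < 2 * n ∧ α ≤ x e ∧ x e ≤ β ∧ y e ≤ γ := by simp [D]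
  -- A stabbed segment exists since `n > 0`; the box is spanned by the extreme ranks of its content.
  have hne : D.Nonempty := by
    by_cases h0 : α ≤ x 0 ∧ x 0 ≤ β ∧ y 0 ≤ γ
    · exact ⟨0, (hD 0).2 ⟨by omega, h0⟩⟩
    · refine ⟨mate 0, (hD _).2 ⟨mate_lt (by omega), ?_⟩⟩
      by_contra h1
      exact h0 ((hst 0 (by omega)).2 h1)
  obtain ⟨p, hpD, hp⟩ := D.exists_min_image X hne
  obtain ⟨q, hqD, hq⟩ := D.exists_max_image X hne
  obtain ⟨r, hrD, hr⟩ := D.exists_max_image Y hne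
  obtain ⟨hp0, hp1, hp2, hp3⟩ := (hD p).1 hpD
  obtain ⟨hq0, hq1, hq2, hq3⟩ := (hD q).1 hqD
  obtain ⟨hr0, hr1, hr2, hr3⟩ := (hD r).1 hrD
  have hin : ∀ e < 2 * n, (α ≤ x e ∧ x e ≤ β ∧ y e ≤ γ) ↔ Inside X Y (X p) (X q) (Y r) e := by
    intro e he
    constructor
    · intro h
      have heD := (hD e).2 ⟨he, h⟩
      exact ⟨hp e heD, hq e heD, hr e heD⟩
    · rintro ⟨h1, h2, h3⟩
      exact ⟨hp1.trans (lexLE_of_rank_le hsP hP hp0 he h1).le,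
        (lexLE_of_rank_le hsP hP he hq0 h2).le.trans hq2,
        (lexLE_of_rank_le hsQ hQ he hr0 h3).le.trans hr3⟩
  have hR : RankStabber (2 * n) P Q X Y (X p) (X q) (Y r) := by
    refine ⟨hP.rank_lt p hp0, hP.rank_lt q hq0, hQ.rank_lt r hr0, ?_, ?_, ?_, fun e he => ?_⟩
    · rw [hP.apply_rank p hp0]; exact (hin p hp0).1 ⟨hp1, hp2, hp3⟩
    · rw [hP.apply_rank q hq0]; exact (hin q hq0).1 ⟨hq1, hq2, hq3⟩
    · rw [hQ.apply_rank r hr0]; exact (hin r hr0).1 ⟨hr1, hr2, hr3⟩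
    · rw [← hin e he, ← hin _ (mate_lt he)]; exact hst e he
  refine ⟨X p, X q, Y r, hR, (noTies_iff hsP hP hsQ hQ hR).2 ?_, hin⟩
  rintro e he ⟨h1, h2, h3⟩
  rw [hP.apply_rank p hp0] at h1
  rw [hP.apply_rank q hq0] at h2
  rw [hQ.apply_rank r hr0] at h3
  exact (hin e he).1 ⟨hp1.trans h1, h2.trans hq2, h3.trans hr3⟩

end

/-- The description of the rectangle with sides through `P a`, `P b` and `Q c`. -/
def describe {n : ℕ} (hn : 0 < n) (P Q : ℕ → ℕ) (t : ℕ × ℕ × ℕ) : Description n where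
  left := ⟨P t.1 % (2 * n), Nat.mod_lt _ (by omega)⟩
  right := ⟨P t.2.1 % (2 * n), Nat.mod_lt _ (by omega)⟩
  top := ⟨Q t.2.2 % (2 * n), Nat.mod_lt _ (by omega)⟩

theorem stabs_iff {n : ℕ} {S : Fin n → Segment} {R : Set (ℝ × ℝ)} :
    Stabs R S ↔ ∀ (e : ℕ) (he : e < 2 * n),
      endpt S ⟨e, he⟩ ∈ R ↔ endpt S ⟨mate e, mate_lt he⟩ ∉ R := by
  have key : ∀ i (hi : i < n) (he : 2 * i < 2 * n) (ho : 2 * i + 1 < 2 * n),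
      endpt S ⟨2 * i, he⟩ = (S ⟨i, hi⟩).p ∧ endpt S ⟨2 * i + 1, ho⟩ = (S ⟨i, hi⟩).q := by
    intro i hi he ho
    have h1 : 2 * i / 2 = i := by omega
    have h2 : (2 * i + 1) / 2 = i := by omega
    have h3 : (2 * i + 1) % 2 = 1 := by omega
    simp [endpt, h2, h3]
  constructor
  · intro h e he
    have hi : e / 2 < n := by omega
    obtain ⟨k1, k2⟩ := key (e / 2) hi (by omega) (by omega)
    have := h ⟨e / 2, hi⟩
    rw [← k1, ← k2] at this
    obtain h0 | h0 : e % 2 = 0 ∨ e % 2 = 1 := by omega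
    · have e1 : (⟨e, he⟩ : Fin (2 * n)) = ⟨2 * (e / 2), by omega⟩ := Fin.ext (by simp; omega)
      have e2 : (⟨mate e, mate_lt he⟩ : Fin (2 * n)) = ⟨2 * (e / 2) + 1, by omega⟩ :=
        Fin.ext (by simp [mate]; omega)
      rw [e1, e2]; tauto
    · have e1 : (⟨e, he⟩ : Fin (2 * n)) = ⟨2 * (e / 2) + 1, by omega⟩ := Fin.ext (by simp; omega)
      have e2 : (⟨mate e, mate_lt he⟩ : Fin (2 * n)) = ⟨2 * (e / 2), by omega⟩ :=
        Fin.ext (by simp [mate]; omega)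
      rw [e1, e2]; tauto
  · rintro h ⟨i, hi⟩
    obtain ⟨k1, k2⟩ := key i hi (by omega) (by omega)
    have := h (2 * i) (by omega)
    have e2 : (⟨mate (2 * i), mate_lt (by omega)⟩ : Fin (2 * n)) = ⟨2 * i + 1, by omega⟩ :=
      Fin.ext (by simp [mate]; omega)
    rw [e2, k1, k2] at this
    tauto

theorem combEquiv_iff {n : ℕ} {S : Fin n → Segment} {R R' : Set (ℝ × ℝ)} :
    CombEquiv S R R' ↔ ∀ e : Fin (2 * n), endpt S e ∈ R ↔ endpt S e ∈ R' := by
  have hmem : ∀ z, z ∈ endpoints S ↔ ∃ e : Fin (2 * n), z = endpt S e := by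
    intro z
    constructor
    · rintro ⟨i, rfl | rfl⟩
      · refine ⟨⟨2 * i, by omega⟩, ?_⟩
        simp [endpt]
      · refine ⟨⟨2 * i + 1, by omega⟩, ?_⟩
        have h2 : (2 * (i : ℕ) + 1) / 2 = i := by omega
        have h3 : (2 * (i : ℕ) + 1) % 2 = 1 := by omega
        simp [endpt, h2, h3]
    · rintro ⟨e, rfl⟩
      refine ⟨⟨e / 2, by omega⟩, ?_⟩
      unfold endpt
      split_ifs
      · exact .inl rfl
      · exact .inr rfl
  constructor
  · intro h e
    have := Set.ext_iff.1 h (endpt S e)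
    have he := (hmem _).2 ⟨e, rfl⟩
    simp only [Set.mem_inter_iff, he, and_true] at this
    exact this
  · intro h
    ext z
    simp only [Set.mem_inter_iff, hmem]
    constructor
    · rintro ⟨hz, e, rfl⟩; exact ⟨(h e).1 hz, e, rfl⟩
    · rintro ⟨hz, e, rfl⟩; exact ⟨(h e).2 hz, e, rfl⟩

theorem listsAllStabbers {n : ℕ} (hn : 0 < n) (S : Fin n → Segment) {P Q X Y : ℕ → ℕ}
    {x y : ℕ → ℝ} (hx : ∀ e : Fin (2 * n), endpt S e = (x e, y e))
    (hsP : SortedPerm (LexLE x y) (2 * n) P) (hP : Ranking (2 * n) P X)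
    (hsQ : SortedPerm (LexLE y x) (2 * n) Q) (hQ : Ranking (2 * n) Q Y)
    {L : List (ℕ × ℕ × ℕ)} (hL : L.Nodup)
    (hmem : ∀ a b c, (a, b, c) ∈ L ↔
      RankStabber (2 * n) P Q X Y a b c ∧ NoTies (2 * n) P Q x y a b c) :
    ListsAllStabbers S (L.map (describe hn P Q)) := by
  have hreg : ∀ a b c, (a, b, c) ∈ L → ∀ e : Fin (2 * n),
      endpt S e ∈ (describe hn P Q (a, b, c)).region S ↔ Inside X Y a b c e := by
    intro a b c h e
    obtain ⟨hR, hT⟩ := (hmem a b c).1 h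
    -- The reduction modulo `2 * n` only makes `describe` total; it is the identity on the listed
    -- triples.
    have h1 := Nat.mod_eq_of_lt (hP.lt a hR.left_lt)
    have h2 := Nat.mod_eq_of_lt (hP.lt b hR.right_lt)
    have h3 := Nat.mod_eq_of_lt (hQ.lt c hR.top_lt)
    simp only [Description.region, bottomless, describe, hx, Set.mem_ofPred_eq, h1, h2, h3]
    exact ⟨(noTies_iff hsP hP hsQ hQ hR).1 hT e e.2, inside_imp hsP hP hsQ hQ hR e.2⟩
  have hstab : ∀ a b c, (a, b, c) ∈ L → Stabs ((describe hn P Q (a, b, c)).region S) S := by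
    intro a b c h
    rw [stabs_iff]
    intro e he
    rw [hreg a b c h, hreg a b c h]
    exact ((hmem a b c).1 h).1.stabs e he
  refine ⟨?_, ?_, ?_, ?_⟩
  · intro d hd
    obtain ⟨⟨a, b, c⟩, h, rfl⟩ := List.mem_map.1 hd
    obtain ⟨hR, hT⟩ := (hmem a b c).1 h
    refine ⟨(hreg a b c h _).2 ?_, (hreg a b c h _).2 ?_, (hreg a b c h _).2 ?_⟩
    · simpa [describe, Nat.mod_eq_of_lt (hP.lt a hR.left_lt)] using hR.left
    · simpa [describe, Nat.mod_eq_of_lt (hP.lt b hR.right_lt)] using hR.right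
    · simpa [describe, Nat.mod_eq_of_lt (hQ.lt c hR.top_lt)] using hR.top
  · intro d hd
    obtain ⟨⟨a, b, c⟩, h, rfl⟩ := List.mem_map.1 hd
    exact hstab a b c h
  · rw [List.pairwise_map]
    refine List.Pairwise.imp_of_mem ?_ hL
    rintro ⟨a, b, c⟩ ⟨a', b', c'⟩ h h' hne heq
    refine hne (((hmem a b c).1 h).1.eq_of_inside_iff ((hmem a' b' c').1 h').1 hP hQ fun e he => ?_)
    have := combEquiv_iff.1 heq ⟨e, he⟩
    rwa [hreg a b c h, hreg a' b' c' h'] at this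
  · rintro R ⟨α, β, γ, -, rfl⟩ hst
    obtain ⟨a, b, c, hR, hT, hin⟩ := exists_rankStabber hsP hP hsQ hQ hn (α := α) (β := β) (γ := γ)
      (by
        intro e he
        have := stabs_iff.1 hst e he
        simpa only [bottomless, hx, Set.mem_ofPred_eq] using this)
    have h := (hmem a b c).2 ⟨hR, hT⟩
    refine ⟨_, List.mem_map.2 ⟨_, h, rfl⟩, combEquiv_iff.2 fun e => ?_⟩
    rw [hreg a b c h, ← hin e e.2]
    simp only [bottomless, hx, Set.mem_ofPred_eq]


notation "firstTop" => (28 : ℕ)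
notation "firstResult" => (29 : ℕ)
notation "permX" => (30 : ℕ)
notation "outLeft" => (31 : ℕ)
notation "outRight" => (32 : ℕ)
notation "outTop" => (33 : ℕ)
notation "outFlag" => (34 : ℕ)

/-! ### The output -/

section

open Classical in
/-- The rectangles that are reported in step `k`: the one that the first sweep found for the left
side `k`, and the one that the second sweep found for the right side `N - 1 - k` unless it was also
found by the first sweep. -/
noncomputable def reported (N : ℕ) (P Q : ℕ → ℕ) (x y : ℕ → ℝ) (R C R' C' : ℕ → ℕ) (k : ℕ) :
    List (ℕ × ℕ × ℕ) :=
  (if 1 ≤ R k ∧ NoTies N P Q x y k (R k - 1) (C k) then [(k, R k - 1, C k)] else []) ++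
  if (1 ≤ R' k ∧ C (N - R' k) ≠ C' k) ∧ NoTies N P Q x y (N - R' k) (N - 1 - k) (C' k) then
    [(N - R' k, N - 1 - k, C' k)] else []

variable {n N a b c k : ℕ} {P Q X Y P' X' R C R' C' : ℕ → ℕ} {x y : ℕ → ℝ}

theorem mem_reported : (a, b, c) ∈ reported N P Q x y R C R' C' k ↔
    (a = k ∧ b = R k - 1 ∧ c = C k ∧ 1 ≤ R k ∧ NoTies N P Q x y a b c) ∨
    (a = N - R' k ∧ b = N - 1 - k ∧ c = C' k ∧ 1 ≤ R' k ∧ C a ≠ c ∧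
      NoTies N P Q x y a b c) := by
  unfold reported
  rw [List.mem_append]
  refine or_congr ?_ ?_
  · split_ifs with h
    · simp only [List.mem_singleton, Prod.mk.injEq]
      constructor
      · rintro ⟨rfl, rfl, rfl⟩; exact ⟨rfl, rfl, rfl, h⟩
      · rintro ⟨rfl, rfl, rfl, -⟩; exact ⟨rfl, rfl, rfl⟩
    · simp only [List.not_mem_nil, false_iff]
      rintro ⟨rfl, rfl, rfl, h1, h2⟩
      exact h ⟨h1, h2⟩
  · split_ifs with h
    · simp only [List.mem_singleton, Prod.mk.injEq]
      constructor
      · rintro ⟨rfl, rfl, rfl⟩; exact ⟨rfl, rfl, rfl, h.1.1, h.1.2, h.2⟩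
      · rintro ⟨rfl, rfl, rfl, -⟩; exact ⟨rfl, rfl, rfl⟩
    · simp only [List.not_mem_nil, false_iff]
      rintro ⟨rfl, rfl, rfl, h1, h2, h3⟩
      exact h ⟨⟨h1, h2⟩, h3⟩

/-- This needs no assumption on the arrays. A first-sweep triple has `c = C a` and determines `k` by
`a`; a second-sweep triple has `c ≠ C a` and determines `k` by `b`. -/
theorem nodup_reported :
    ((List.range N).flatMap (reported N P Q x y R C R' C')).Nodup := by
  rw [List.nodup_flatMap]
  constructor
  · intro k _
    unfold reported
    split_ifs with h1 h2
    · rw [List.singleton_append, List.nodup_cons]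
      refine ⟨?_, List.nodup_singleton _⟩
      simp only [List.mem_singleton, Prod.mk.injEq]
      rintro ⟨h3, h4, h5⟩
      exact h2.1.2 (h3 ▸ h5)
    all_goals simp
  · rw [List.pairwise_iff_getElem]
    intro i j hi hj hij
    simp only [List.length_range] at hi hj
    simp only [List.getElem_range, Function.onFun]
    rintro ⟨a, b, c⟩ h1 h2
    rw [mem_reported] at h1 h2
    obtain ⟨h3, -, h4, -⟩ | ⟨-, h5, -, -, h6, -⟩ := h1
    · obtain ⟨h7, -, h8, -⟩ | ⟨-, h9, -, -, h10, -⟩ := h2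
      · omega
      · subst h3; exact h10 h4.symm
    · obtain ⟨h7, -, h8, -⟩ | ⟨-, h9, -, -, h10, -⟩ := h2
      · subst h7; exact h6 h8.symm
      · omega

/-- The arrays `R` and `C` hold the result of a sweep. -/
def SweepResult (n : ℕ) (P Q X Y R C : ℕ → ℕ) : Prop :=
  (∀ a < 2 * n, C a = topOf (2 * n) P Y a) ∧
  (∀ a < 2 * n, Accepts n P Q X Y a → R a = rightOf (2 * n) P Q X Y a + 1) ∧
  ∀ a < 2 * n, ¬ Accepts n P Q X Y a → R a = 0

theorem SweepResult.rankStabber (h : SweepResult n P Q X Y R C) (hP : Ranking (2 * n) P X)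
    (hQ : Ranking (2 * n) Q Y) (hk : k < 2 * n) (hR : 1 ≤ R k) :
    RankStabber (2 * n) P Q X Y k (R k - 1) (C k) := by
  obtain ⟨h1, h2, h3⟩ := h
  have hacc : Accepts n P Q X Y k := by
    by_contra hacc
    have := h3 k hk hacc
    omega
  rw [h2 k hk hacc, h1 k hk]
  exact (accepts_iff hP hQ hk).1 hacc

theorem SweepResult.result_eq (h : SweepResult n P Q X Y R C) (hP : Ranking (2 * n) P X)
    (hQ : Ranking (2 * n) Q Y) (hR : RankStabber (2 * n) P Q X Y a b c)
    (hc : c = topOf (2 * n) P Y a) : R a = b + 1 ∧ C a = c := by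
  obtain ⟨h1, h2, h3⟩ := h
  have hb := hR.right_eq hP hQ hc
  refine ⟨?_, by rw [h1 a hR.left_lt, hc]⟩
  rw [hb, h2 a hR.left_lt]
  rw [accepts_iff hP hQ hR.left_lt, ← hb, ← hc]
  exact hR

theorem SweepResult.rankStabber_of_rev (h : SweepResult n P' Q X' Y R C)
    (hP : Ranking (2 * n) P X) (hQ : Ranking (2 * n) Q Y) (hPr : Ranking (2 * n) P' X')
    (hP' : ∀ k < 2 * n, P' k = P (2 * n - 1 - k)) (hX' : ∀ e < 2 * n, X' e = 2 * n - 1 - X e)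
    (hk : k < 2 * n) (hR : 1 ≤ R k) :
    RankStabber (2 * n) P Q X Y (2 * n - R k) (2 * n - 1 - k) (C k) := by
  have h1 := h.rankStabber hPr hQ hk hR
  have h2 := h1.right_lt
  rw [← rankStabber_rev_iff hP hQ hP' hX' (by omega) (by omega)]
  convert h1 using 1 <;> omega

/-- By `RankStabber.top_eq` the top of a stabber is the bound from the left or, failing that, from
the right. In the second case `c` differs from `topOf` at `a`, so the filter against duplicates lets
the triple pass. -/
theorem mem_flatMap_reported (h : SweepResult n P Q X Y R C) (h' : SweepResult n P' Q X' Y R' C')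
    (hP : Ranking (2 * n) P X) (hQ : Ranking (2 * n) Q Y) (hPr : Ranking (2 * n) P' X')
    (hP' : ∀ k < 2 * n, P' k = P (2 * n - 1 - k)) (hX' : ∀ e < 2 * n, X' e = 2 * n - 1 - X e) :
    (a, b, c) ∈ (List.range (2 * n)).flatMap (reported (2 * n) P Q x y R C R' C') ↔
      RankStabber (2 * n) P Q X Y a b c ∧ NoTies (2 * n) P Q x y a b c := by
  simp only [List.mem_flatMap, List.mem_range, mem_reported]
  constructor
  · rintro ⟨k, hk, ⟨rfl, rfl, rfl, h1, h2⟩ | ⟨rfl, rfl, rfl, h1, -, h2⟩⟩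
    · exact ⟨h.rankStabber hP hQ hk h1, h2⟩
    · exact ⟨h'.rankStabber_of_rev hP hQ hPr hP' hX' hk h1, h2⟩
  · rintro ⟨hR, hT⟩
    have ha := hR.left_lt
    have hb := hR.right_lt
    by_cases hc : c = topOf (2 * n) P Y a
    · obtain ⟨h1, h2⟩ := h.result_eq hP hQ hR hc
      exact ⟨a, ha, .inl ⟨rfl, by omega, h2.symm, by omega, hT⟩⟩
    · obtain ⟨h1, h2⟩ := h'.result_eq hPr hQ
        ((rankStabber_rev_iff hP hQ hP' hX' ha hb).2 hR)
        ((hR.top_eq hP hQ hPr hP' hX').resolve_left hc)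
      refine ⟨2 * n - 1 - b, by omega, .inr ⟨by omega, by omega, h2.symm, by omega, ?_, hT⟩⟩
      rw [h.1 a ha]
      exact fun h => hc h.symm

end

/-- The test of `NoTies`. -/
def noTiesTest : Test :=
  .and (.not (.and (.natLE (.const 1) (var outLeft))
    (.realLE 0 (.read permX (var outLeft)) 0 (.read permX (.sub (var outLeft) (.const 1))))))
  (.and (.not (.and (.natLE (.add (var outRight) (.const 2)) (var nPoints))
    (.and (.realLE 0 (.read permX (.add (var outRight) (.const 1)))
        0 (.read permX (var outRight)))
      (.realLE 1 (.read permX (.add (var outRight) (.const 1))) 1 (.read permY (var outTop))))))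
  (.not (.and (.natLE (.add (var outTop) (.const 2)) (var nPoints))
    (.and (.realLE 1 (.read permY (.add (var outTop) (.const 1))) 1 (.read permY (var outTop)))
    (.and (.realLE 0 (.read permX (var outLeft)) 0 (.read permY (.add (var outTop) (.const 1))))
      (.realLE 0 (.read permY (.add (var outTop) (.const 1)))
        0 (.read permX (var outRight))))))))

/-- Append the current rectangle to the output if the flag is set and there are no ties. -/
def emit : Program :=
  .branch (.and (.natLE (.const 1) (var outFlag)) noTiesTest)
    (.seq (.store 1 (var 0) (.read permX (var outLeft)))
      (.seq (.store 2 (var 0) (.read permX (var outRight)))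
        (.seq (.store 3 (var 0) (.read permY (var outTop)))
          (assign 0 (.add (var 0) (.const 1))))))
    .skip

/-- Report the result of the first sweep for the left side `counter`. -/
def reportFirst : Program :=
  .seq (.seq (assign outFlag (.read firstResult (var counter)))
    (.seq (assign outLeft (var counter))
      (.seq (assign outRight (.sub (.read firstResult (var counter)) (.const 1)))
        (assign outTop (.read firstTop (var counter)))))) emit

/-- Report the result of the second sweep for the right side with rank `counter` from the right,
unless it is also a result of the first sweep. -/
def reportSecond : Program :=
  .seq (.seq (assign outFlag (.read resultArr (var counter)))
    (.seq (assign outLeft (.sub (var nPoints) (.read resultArr (var counter))))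
      (.seq (assign outRight (.sub (.sub (var nPoints) (.const 1)) (var counter)))
        (.seq (assign outTop (.read topArr (var counter)))
          (.branch (.and (.natLE (.read firstTop (var outLeft)) (var outTop))
              (.natLE (var outTop) (.read firstTop (var outLeft))))
            (assign outFlag (.const 0)) .skip))))) emit

/-- The list `L` has been output. -/
def Written (P Q : ℕ → ℕ) (L : List (ℕ × ℕ × ℕ)) (m : Memory) : Prop :=
  m.nat 0 0 = L.length ∧ ∀ (j : ℕ) (hj : j < L.length),
    m.nat 1 j = P L[j].1 ∧ m.nat 2 j = P L[j].2.1 ∧ m.nat 3 j = Q L[j].2.2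

section

variable {N W : ℕ} {P Q : ℕ → ℕ} {m : Memory} {L : List (ℕ × ℕ × ℕ)}

open Classical in
theorem runs_emit {a b c : ℕ} (hN : m.nat nPoints 0 = N) (hP : ∀ k < N, m.nat permX k = P k)
    (hQ : ∀ k < N, m.nat permY k = Q k) (hPN : ∀ k < N, P k < N) (hQN : ∀ k < N, Q k < N)
    (hW : 2 * N + 1 < W) (hL : Written P Q L m) (hlen : L.length < 2 * N)
    (ha : m.nat outLeft 0 = a) (hb : m.nat outRight 0 = b) (hc : m.nat outTop 0 = c)
    (hlt : 1 ≤ m.nat outFlag 0 → a < N ∧ b < N ∧ c < N) :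
    Runs W emit m 200 (Written P Q (L ++
      if 1 ≤ m.nat outFlag 0 ∧ NoTies N P Q (m.real 0) (m.real 1) a b c then [(a, b, c)]
      else [])) := by
  have htest : (Test.and (.natLE (.const 1) (var outFlag)) noTiesTest).Holds m ↔
      1 ≤ m.nat outFlag 0 ∧ NoTies N P Q (m.real 0) (m.real 1) a b c := by
    -- Without the flag the sides may be out of range. All conjuncts are evaluated anyway, but the
    -- values read do not matter then; the reads at `b + 1` and `c + 1` are guarded in the same way.
    refine and_congr_right fun hflag => ?_
    obtain ⟨ha', hb', hc'⟩ := hlt hflag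
    simp only [noTiesTest, Test.Holds, NExp.eval, NoTies, ha, hb, hc, hN, hP a ha', hP b hb',
      hQ c hc', hP (a - 1) (by omega)]
    refine and_congr Iff.rfl (and_congr (not_congr (and_congr_right fun h => ?_))
      (not_congr (and_congr_right fun h => ?_)))
    · rw [hP (b + 1) (by omega)]
    · rw [hQ (c + 1) (by omega)]
  refine .of_wp (by simp [emit, Program.NatOnly]) (by decide) ?_
  simp only [emit, Program.wp, htest]
  refine ⟨fun h => ?_, fun h => ?_⟩
  · obtain ⟨ha', hb', hc'⟩ := hlt h.1
    have h1 := hPN a ha'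
    have h2 := hPN b hb'
    have h3 := hQN c hc'
    rw [if_pos h]
    simp only [NExp.eval, Memory.nat_setNat_of_ne, ne_eq, Nat.reduceEqDiff, not_false_eq_true,
      OfNat.zero_ne_ofNat, OfNat.ofNat_ne_one, zero_ne_one, ha, hb, hc, hL.1, hP a ha',
      hP b hb', hQ c hc']
    refine ⟨by omega, by omega, by omega, by omega, by simp, fun j hj => ?_⟩
    simp only [List.length_append, List.length_singleton] at hj
    obtain rfl | hj' := Nat.eq_or_lt_of_le (Nat.le_of_lt_succ hj)
    · simp
    · have := hL.2 j hj'
      simpa [List.getElem_append_left hj', Function.update_apply, hj'.ne] using this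
  · rw [if_neg h]
    simpa using hL

end


/-- Report the results of both sweeps. -/
def reportProgram : Program :=
  forLoop counter nPoints (.seq reportFirst reportSecond)

/-- The memory holds the two enumerations and the results of the two sweeps. -/
structure ReportInput (N : ℕ) (P Q R C R' C' : ℕ → ℕ) (m : Memory) : Prop where
  points : m.nat nPoints 0 = N
  permX_eq : ∀ k < N, m.nat permX k = P k
  permY_eq : ∀ k < N, m.nat permY k = Q k
  firstResult_eq : m.nat firstResult = R
  firstTop_eq : m.nat firstTop = C
  result_eq : m.nat resultArr = R'
  top_eq : m.nat topArr = C'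

section

variable {N W k : ℕ} {P Q R C R' C' : ℕ → ℕ} {m : Memory} {L : List (ℕ × ℕ × ℕ)}

theorem ReportInput.frame {m' : Memory} {l : List ℕ} (h : ReportInput N P Q R C R' C' m)
    (hf : Frame l m m')
    (hl : ∀ a ∈ [nPoints, permX, permY, firstResult, firstTop, resultArr, topArr], a ∉ l) :
    ReportInput N P Q R C R' C' m' := by
  obtain ⟨h1, h2, h3, h4, h5, h6, h7⟩ := h
  refine ⟨?_, ?_, ?_, ?_, ?_, ?_, ?_⟩ <;> rw [hf.2 _ (hl _ (by simp))] <;> assumption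

theorem Written.frame {m' : Memory} {l : List ℕ} (h : Written P Q L m) (hf : Frame l m m')
    (hl : ∀ a ∈ [0, 1, 2, 3], a ∉ l) : Written P Q L m' := by
  unfold Written at h ⊢
  rwa [hf.2 0 (hl _ (by simp)), hf.2 1 (hl _ (by simp)), hf.2 2 (hl _ (by simp)),
    hf.2 3 (hl _ (by simp))]

open Classical in
theorem runs_reportFirst (h : ReportInput N P Q R C R' C' m) (hk : m.nat counter 0 = k)
    (hkN : k < N) (hPN : ∀ k < N, P k < N) (hQN : ∀ k < N, Q k < N) (hW : 2 * N + 1 < W)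
    (hL : Written P Q L m) (hlen : L.length < 2 * N) (hR : R k ≤ N) (hC : C k < N) :
    Runs W reportFirst m 250 (Written P Q (L ++
      if 1 ≤ R k ∧ NoTies N P Q (m.real 0) (m.real 1) k (R k - 1) (C k) then
        [(k, R k - 1, C k)] else [])) := by
  refine Runs.seq (T := 50) (U := 200) (Q := fun m' => m'.nat outFlag 0 = R k ∧
    m'.nat outLeft 0 = k ∧ m'.nat outRight 0 = R k - 1 ∧ m'.nat outTop 0 = C k)
    (.of_wp (by simp [Program.NatOnly]) (by decide) ?_) ?_ (by omega)
  · simp [Program.wp, NExp.eval, hk, h.firstResult_eq, h.firstTop_eq]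
    omega
  · rintro m' hf ⟨h1, h2, h3, h4⟩
    have h' := h.frame hf (by decide)
    have hL' := hL.frame hf (by decide)
    have := runs_emit h'.points h'.permX_eq h'.permY_eq hPN hQN hW hL' hlen h2 h3 h4
      (by omega)
    rwa [h1, hf.1] at this

open Classical in
theorem runs_reportSecond (h : ReportInput N P Q R C R' C' m) (hk : m.nat counter 0 = k)
    (hkN : k < N) (hPN : ∀ k < N, P k < N) (hQN : ∀ k < N, Q k < N) (hW : 2 * N + 1 < W)
    (hL : Written P Q L m) (hlen : L.length < 2 * N) (hR : R' k ≤ N) (hC : C' k < N) :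
    Runs W reportSecond m 300 (Written P Q (L ++
      if (1 ≤ R' k ∧ C (N - R' k) ≠ C' k) ∧
          NoTies N P Q (m.real 0) (m.real 1) (N - R' k) (N - 1 - k) (C' k) then
        [(N - R' k, N - 1 - k, C' k)] else [])) := by
  refine Runs.seq (T := 80) (U := 200) (Q := fun m' =>
    -- If `R' k = 0`, the comparison reads `C` at `N`, beyond the meaningful cells, but the flag is
    -- 0 either way.
    (1 ≤ m'.nat outFlag 0 ↔ 1 ≤ R' k ∧ C (N - R' k) ≠ C' k) ∧
    m'.nat outLeft 0 = N - R' k ∧ m'.nat outRight 0 = N - 1 - k ∧ m'.nat outTop 0 = C' k)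
    (.of_wp (by simp [Program.NatOnly]) (by decide) ?_) ?_ (by omega)
  · simp [Program.wp, NExp.eval, Test.Holds, hk, h.result_eq, h.top_eq, h.points, h.firstTop_eq]
    omega
  · rintro m' hf ⟨h1, h2, h3, h4⟩
    have h' := h.frame hf (by decide)
    have hL' := hL.frame hf (by decide)
    have := runs_emit h'.points h'.permX_eq h'.permY_eq hPN hQN hW hL' hlen h2 h3 h4
      (by omega)
    simp only [h1, hf.1] at this
    exact this

theorem length_flatMap_reported_le (x y : ℕ → ℝ) (k : ℕ) :
    ((List.range k).flatMap (reported N P Q x y R C R' C')).length ≤ 2 * k := by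
  induction k with
  | zero => simp
  | succ k ih =>
    have : (reported N P Q x y R C R' C' k).length ≤ 2 := by
      unfold reported
      split_ifs <;> simp
    simp only [List.range_succ, List.flatMap_append, List.length_append, List.flatMap_cons,
      List.flatMap_nil, List.append_nil]
    omega

theorem runs_reportProgram (h : ReportInput N P Q R C R' C' m)
    (hPN : ∀ k < N, P k < N) (hQN : ∀ k < N, Q k < N) (hW : 2 * N + 1 < W)
    (h0 : m.nat 0 0 = 0) (hR : ∀ k < N, R k ≤ N) (hC : ∀ k < N, C k < N)
    (hR' : ∀ k < N, R' k ≤ N) (hC' : ∀ k < N, C' k < N) :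
    Runs W reportProgram m (600 * N + 11)
      (Written P Q ((List.range N).flatMap (reported N P Q (m.real 0) (m.real 1) R C R' C'))) := by
  refine Runs.forLoop (N := N) (T := 550)
    (fun k => Written P Q ((List.range k).flatMap
      (reported N P Q (m.real 0) (m.real 1) R C R' C')))
    (by decide) (by decide) h.points (by omega) ⟨by simpa using h0, by simp⟩ ?_ (by omega)
  intro k m₁ hk hf hkm hL
  have h₁ := h.frame hf (by decide)
  have hlen := length_flatMap_reported_le (N := N) (P := P) (Q := Q) (R := R) (C := C) (R' := R')
    (C' := C') (m.real 0) (m.real 1) k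
  refine Runs.seq (runs_reportFirst h₁ hkm hk hPN hQN hW hL (by omega) (hR k hk) (hC k hk))
    (U := 300) ?_ (by omega)
  intro m₂ hf₂ hL₂
  refine (runs_reportSecond (h₁.frame hf₂ (by decide)) (by rw [hf₂.2 _ (by decide), hkm]) hk hPN
    hQN hW hL₂ ?_ (hR' k hk) (hC' k hk)).mono le_rfl ?_
  · rw [List.length_append]
    split_ifs <;> simp only [List.length_singleton, List.length_nil] <;> omega
  · intro m₃ hf₃ hL₃
    have hr₁ := hf.1
    have hr₂ := hf₂.1
    have := hL₃.frame (Frame.setNat m₃ 0 (k + 1) (List.mem_singleton_self counter)) (by decide)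
    rw [hr₂, hr₁] at this
    simpa [List.range_succ, List.flatMap_append, reported, List.append_assoc] using this

end

/-! ### The complete program -/

/-- Store the value of `e` in each of the first cells of the array `dst`. -/
def fillLoop (dst : ℕ) (e : NExp) : Program :=
  forLoop counter nPoints (.store dst (var counter) e)

/-- Store the inverse of `perm` in the array `r`. -/
def rankLoop (r : ℕ) : Program :=
  forLoop counter nPoints (.store r (.read perm (var counter)) (var counter))

section

variable {N W dst r : ℕ} {m : Memory}

theorem runs_fillLoop {e : NExp} {g : ℕ → ℕ} (hN : m.nat nPoints 0 = N) (hW : 2 * N + 1 < W)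
    (hdst : dst ∉ [nPoints, counter]) (hg : ∀ k < N, g k ≤ N)
    (he : ∀ k < N, ∀ m', Frame [counter, dst] m m' → m'.nat counter 0 = k → e.eval m' = g k)
    (hc : e.cost ≤ 20) :
    Runs W (fillLoop dst e) m (60 * N + 11) fun m' => ∀ k < N, m'.nat dst k = g k := by
  simp only [List.mem_cons, List.not_mem_nil, or_false, not_or] at hdst
  refine Runs.forLoop (N := N) (T := 30) (fun k m' => ∀ j < k, m'.nat dst j = g j)
    (by simp [Program.writes]; omega) (by simp [Program.writes]; omega) hN (by omega) (by simp)
    ?_ (by omega)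
  intro k m' hk hf hkm hI
  have h1 := he k hk m' (hf.mono (by simp [Program.writes])) hkm
  have h2 := hg k hk
  refine .of_wp trivial (by simp [Program.time, NExp.cost]; omega) ?_
  simp only [Program.wp, NExp.eval, hkm, h1]
  refine ⟨by omega, fun j hj => ?_⟩
  rw [Memory.nat_setNat_of_ne _ _ _ _ _ hdst.2, Memory.nat_setNat_self]
  obtain rfl | hlt := Nat.eq_or_lt_of_le (Nat.le_of_lt_succ hj)
  · simp
  · simpa [hlt.ne] using hI j hlt

/-- Injectivity guarantees that later rounds do not overwrite earlier entries. -/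
theorem runs_rankLoop (hN : m.nat nPoints 0 = N) (hW : 2 * N + 1 < W)
    (hr : r ∉ [nPoints, counter, perm])
    (hinj : ∀ i < N, ∀ j < N, m.nat perm i = m.nat perm j → i = j) :
    Runs W (rankLoop r) m (60 * N + 11) fun m' => ∀ k < N, m'.nat r (m.nat perm k) = k := by
  simp only [List.mem_cons, List.not_mem_nil, or_false, not_or] at hr
  refine Runs.forLoop (N := N) (T := 30) (fun k m' => ∀ j < k, m'.nat r (m.nat perm j) = j)
    (by simp [Program.writes]; omega) (by simp [Program.writes]; omega) hN (by omega) (by simp)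
    ?_ (by omega)
  intro k m' hk hf hkm hI
  have h1 : m'.nat perm = m.nat perm := hf.2 _ (by simp [Program.writes]; omega)
  refine .of_wp trivial (by simp [Program.time, NExp.cost]) ?_
  simp only [Program.wp, NExp.eval, hkm, h1]
  refine ⟨by omega, fun j hj => ?_⟩
  rw [Memory.nat_setNat_of_ne _ _ _ _ _ hr.2.1, Memory.nat_setNat_self]
  obtain rfl | hlt := Nat.eq_or_lt_of_le (Nat.le_of_lt_succ hj)
  · simp
  · have : m.nat perm j ≠ m.nat perm k := fun h => hlt.ne (hinj j (by omega) k hk h)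
    simpa [this] using hI j hlt

end

theorem ranking_of_sortedPerm {le : ℕ → ℕ → Prop} {N : ℕ} {P X : ℕ → ℕ} (h : SortedPerm le N P)
    (hX : ∀ k < N, X (P k) = k) : Ranking N P X := by
  refine ⟨h.lt, fun e he => ?_, hX, fun e he => ?_⟩ <;> obtain ⟨i, hi, rfl⟩ := h.surj e he
  · rwa [hX i hi]
  · rw [hX i hi]

theorem _root_.RealRAM.SortedPerm.congr {le : ℕ → ℕ → Prop} {N : ℕ} {P P' : ℕ → ℕ}
    (h : SortedPerm le N P)
    (hP : ∀ k < N, P' k = P k) : SortedPerm le N P' := by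
  refine ⟨fun i hi => hP i hi ▸ h.lt i hi, fun e he => ?_, fun i j hij hj => ?_⟩
  · obtain ⟨i, hi, rfl⟩ := h.surj e he
    exact ⟨i, hi, hP i hi⟩
  · rw [hP i (by omega), hP j hj]; exact h.sorted i j hij hj

/-- Sort the endpoints in both directions. -/
def rankProgram : Program :=
  .seq (.seq (assign nSegments (var 0))
      (.seq (assign nPoints (.mul (.const 2) (var 0))) (assign 0 (.const 0))))
    (.seq (sortProgram 1 0) (.seq (rankLoop rankY) (.seq (fillLoop permY (.read perm (var counter)))
      (.seq (sortProgram 0 1) (rankLoop rankX)))))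

/-- Save the results of the first sweep and reflect the configuration. -/
def reflectProgram : Program :=
  .seq (fillLoop firstTop (.read topArr (var counter)))
    (.seq (fillLoop firstResult (.read resultArr (var counter)))
      (.seq (fillLoop permX (.read perm (var counter)))
        (.seq (fillLoop perm (.read permX (.sub (.sub (var nPoints) (.const 1)) (var counter))))
          (rankLoop rankX))))

/-- Report all combinatorially different stabbing 3-rectangles. -/
def stabbingProgram : Program :=
  .seq rankProgram (.seq sweepProgram (.seq reflectProgram (.seq sweepProgram reportProgram)))


/-! ### Correctness and running time of the assembled program. -/

section

variable {n W : ℕ} {P Q X Y : ℕ → ℕ} {m : Memory}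

/-- Both sorts deliver into `perm`, so the vertical one comes first and is moved to `permY`. Cell 0
of array 0 is cleared after reading `n`, since it becomes the length of the output. -/
theorem runs_rankProgram (hn : 0 < n) (hm : m.nat 0 0 = n) (hW : 4 * n + 1 < W) :
    Runs W rankProgram m (600 * (2 * n + 1) * (Nat.clog 2 (2 * n) + 1) + 400 * n + 100) fun m' =>
      ∃ P Q X Y, Loaded n P Q X Y m' ∧ Ranking (2 * n) P X ∧ Ranking (2 * n) Q Y ∧
        SortedPerm (LexLE (m.real 0) (m.real 1)) (2 * n) P ∧
        SortedPerm (LexLE (m.real 1) (m.real 0)) (2 * n) Q ∧ m'.nat 0 0 = 0 := by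
  have hT : 600 * (2 * n + 1) * (Nat.clog 2 (2 * n) + 1) =
    300 * (2 * n + 1) * (Nat.clog 2 (2 * n) + 1) +
    300 * (2 * n + 1) * (Nat.clog 2 (2 * n) + 1) := by ring
  set K := 300 * (2 * n + 1) * (Nat.clog 2 (2 * n) + 1) with hK
  rw [hT]
  refine Runs.seq (T := 40) (U := K + K + 400 * n + 60) (Q := fun m' =>
    m'.nat nSegments 0 = n ∧ m'.nat nPoints 0 = 2 * n ∧ m'.nat 0 0 = 0)
    (.of_wp (by simp [Program.NatOnly]) (by decide)
      (by simp [Program.wp, NExp.eval, hm]; omega)) ?_ (by omega)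
  rintro m₁ hf₁ ⟨hs₁, hp₁, hz₁⟩
  refine Runs.seq (runs_sortProgram (a := 1) (b := 0) hp₁ (by omega) (by omega))
    (U := K + 400 * n + 60) ?_ (by omega)
  intro m₂ hf₂ hm₂
  rw [hf₁.1] at hm₂
  have hp₂ : m₂.nat nPoints 0 = 2 * n := by rw [hf₂.2 _ (by decide), hp₁]
  refine Runs.seq (runs_rankLoop (r := rankY) hp₂ (by omega) (by decide)
    (fun i hi j hj => hm₂.inj hi hj)) (U := K + 270 * n + 40) ?_ (by omega)
  intro m₃ hf₃ hm₃
  have hp₃ : m₃.nat nPoints 0 = 2 * n := by rw [hf₃.2 _ (by decide), hp₂]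
  have hperm₃ : m₃.nat perm = m₂.nat perm := hf₃.2 _ (by decide)
  refine Runs.seq (runs_fillLoop (g := m₂.nat perm) hp₃ (by omega) (by decide)
    (fun k hk => (hm₂.lt k hk).le) ?_ (by decide)) (U := K + 140 * n + 20) ?_ (by omega)
  · intro k hk m' hf hkm
    simp [NExp.eval, hkm, hf.2 perm (by decide), hperm₃]
  intro m₄ hf₄ hm₄
  have hp₄ : m₄.nat nPoints 0 = 2 * n := by rw [hf₄.2 _ (by decide), hp₃]
  refine Runs.seq (runs_sortProgram (a := 0) (b := 1) hp₄ (by omega) (by omega))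
    (U := 120 * n + 11) ?_ (by omega)
  intro m₅ hf₅ hm₅
  have hr₄ : m₄.real = m.real := by rw [hf₄.1, hf₃.1, hf₂.1, hf₁.1]
  rw [hr₄] at hm₅
  have hp₅ : m₅.nat nPoints 0 = 2 * n := by rw [hf₅.2 _ (by decide), hp₄]
  refine (runs_rankLoop (r := rankX) hp₅ (by omega) (by decide)
    (fun i hi j hj => hm₅.inj hi hj)).mono (by omega) ?_
  intro m₆ hf₆ hm₆
  have hperm₆ : m₆.nat perm = m₅.nat perm := hf₆.2 _ (by decide)
  have hrankY₆ : m₆.nat rankY = m₃.nat rankY := by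
    rw [hf₆.2 _ (by decide), hf₅.2 _ (by decide), hf₄.2 _ (by decide)]
  have hpermY₆ : m₆.nat permY = m₄.nat permY := by
    rw [hf₆.2 _ (by decide), hf₅.2 _ (by decide)]
  have hsQ : SortedPerm (LexLE (m.real 1) (m.real 0)) (2 * n) (m₆.nat permY) :=
    hpermY₆ ▸ hm₂.congr hm₄
  refine ⟨m₆.nat perm, m₆.nat permY, m₆.nat rankX, m₆.nat rankY, ⟨?_, ?_, rfl, rfl, rfl, rfl⟩,
    ?_, ranking_of_sortedPerm hsQ ?_, hperm₆ ▸ hm₅, hsQ, ?_⟩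
  · rw [hf₆.2 _ (by decide), hf₅.2 _ (by decide), hf₄.2 _ (by decide), hf₃.2 _ (by decide),
      hf₂.2 _ (by decide), hs₁]
  · rw [hf₆.2 _ (by decide), hp₅]
  · rw [hperm₆]
    exact ranking_of_sortedPerm hm₅ hm₆
  · intro k hk
    rw [hpermY₆, hm₄ k hk, hrankY₆, hm₃ k hk]
  · rw [hf₆.2 _ (by decide), hf₅.2 _ (by decide), hf₄.2 _ (by decide), hf₃.2 _ (by decide),
      hf₂.2 _ (by decide), hz₁]

/-- Reversing `perm` and recomputing `rankX` lets the same sweep program serve the right sides;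
`permX` keeps the original order for the output. -/
theorem runs_reflectProgram (h : Loaded n P Q X Y m) (hP : Ranking (2 * n) P X)
    (hW : 4 * n + 1 < W) (hC : ∀ k < 2 * n, m.nat topArr k ≤ 2 * n)
    (hR : ∀ k < 2 * n, m.nat resultArr k ≤ 2 * n) :
    Runs W reflectProgram m (600 * n + 55) fun m' =>
      (∃ P' X', Loaded n P' Q X' Y m' ∧ Ranking (2 * n) P' X' ∧
        (∀ k < 2 * n, P' k = P (2 * n - 1 - k)) ∧ ∀ e < 2 * n, X' e = 2 * n - 1 - X e) ∧
      (∀ k < 2 * n, m'.nat permX k = P k) ∧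
      (∀ k < 2 * n, m'.nat firstTop k = m.nat topArr k) ∧
      ∀ k < 2 * n, m'.nat firstResult k = m.nat resultArr k := by
  refine Runs.seq (runs_fillLoop h.points (by omega) (by decide) hC ?_ (by decide))
    (U := 480 * n + 44) ?_ (by omega)
  · intro k hk m' hf hkm
    simp [NExp.eval, hkm, hf.2 topArr (by decide)]
  intro m₁ hf₁ hm₁
  have h₁ := h.frame hf₁ (by decide)
  refine Runs.seq (runs_fillLoop h₁.points (by omega) (by decide) hR ?_ (by decide))
    (U := 360 * n + 33) ?_ (by omega)
  · intro k hk m' hf hkm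
    simp [NExp.eval, hkm, hf.2 resultArr (by decide), hf₁.2 resultArr (by decide)]
  intro m₂ hf₂ hm₂
  have h₂ := h₁.frame hf₂ (by decide)
  refine Runs.seq (runs_fillLoop (g := P) h₂.points (by omega) (by decide)
    (fun k hk => (hP.lt k hk).le) ?_ (by decide)) (U := 240 * n + 22) ?_ (by omega)
  · intro k hk m' hf hkm
    simp [NExp.eval, hkm, hf.2 perm (by decide), h₂.perm_eq]
  intro m₃ hf₃ hm₃
  have h₃ := h₂.frame hf₃ (by decide)
  refine Runs.seq (runs_fillLoop (g := fun k => P (2 * n - 1 - k)) h₃.points (by omega)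
    (by decide) (fun k hk => (hP.lt _ (by omega)).le) ?_ (by decide)) (U := 120 * n + 11) ?_
    (by omega)
  · intro k hk m' hf hkm
    simp only [NExp.eval, hkm, hf.2 permX (by decide), hf.2 nPoints (by decide), h₃.points]
    exact hm₃ _ (by omega)
  intro m₄ hf₄ hm₄
  have hp₄ : m₄.nat nPoints 0 = 2 * n := by rw [hf₄.2 _ (by decide), h₃.points]
  refine (runs_rankLoop (r := rankX) hp₄ (by omega) (by decide) ?_).mono (by omega) ?_
  · intro i hi j hj hij
    rw [hm₄ i hi, hm₄ j hj] at hij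
    have := congrArg X hij
    rw [hP.rank _ (by omega), hP.rank _ (by omega)] at this
    omega
  intro m₅ hf₅ hm₅
  have hperm₅ : m₅.nat perm = m₄.nat perm := hf₅.2 _ (by decide)
  have hP' : ∀ k < 2 * n, m₅.nat perm k = P (2 * n - 1 - k) := by
    intro k hk
    rw [hperm₅, hm₄ k hk]
  have hX' : ∀ e < 2 * n, m₅.nat rankX e = 2 * n - 1 - X e := by
    intro e he
    have h1 := hP.rank_lt e he
    have h2 := hm₅ (2 * n - 1 - X e) (by omega)
    rwa [hm₄ _ (by omega), show 2 * n - 1 - (2 * n - 1 - X e) = X e by omega,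
      hP.apply_rank e he] at h2
  refine ⟨⟨m₅.nat perm, m₅.nat rankX, ⟨?_, ?_, rfl, ?_, rfl, ?_⟩, ?_, hP', hX'⟩, ?_, ?_, ?_⟩
  · rw [hf₅.2 _ (by decide), hf₄.2 _ (by decide), h₃.segments]
  · rw [hf₅.2 _ (by decide), hp₄]
  · rw [hf₅.2 _ (by decide), hf₄.2 _ (by decide), h₃.permY_eq]
  · rw [hf₅.2 _ (by decide), hf₄.2 _ (by decide), h₃.rankY_eq]
  · refine ⟨fun i hi => ?_, fun e he => ?_, fun i hi => ?_, fun e he => ?_⟩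
    · rw [hP' i hi]; exact hP.lt _ (by omega)
    · rw [hX' e he]; omega
    · rw [hP' i hi, hX' _ (hP.lt _ (by omega)), hP.rank _ (by omega)]; omega
    · have := hP.rank_lt e he
      rw [hX' e he, hP' _ (by omega), show 2 * n - 1 - (2 * n - 1 - X e) = X e by omega,
        hP.apply_rank e he]
  · intro k hk
    rw [hf₅.2 _ (by decide), hf₄.2 _ (by decide), hm₃ k hk]
  · intro k hk
    rw [hf₅.2 _ (by decide), hf₄.2 _ (by decide), hf₃.2 _ (by decide), hf₂.2 _ (by decide),
      hm₁ k hk]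
  · intro k hk
    rw [hf₅.2 _ (by decide), hf₄.2 _ (by decide), hf₃.2 _ (by decide), hm₂ k hk]

theorem SweepResult.bounds {R C : ℕ → ℕ} (h : SweepResult n P Q X Y R C)
    (hP : Ranking (2 * n) P X) (hQ : Ranking (2 * n) Q Y) {k : ℕ} (hk : k < 2 * n) :
    R k ≤ 2 * n ∧ C k < 2 * n := by
  obtain ⟨h1, h2, h3⟩ := h
  refine ⟨?_, h1 k hk ▸ topOf_lt hP hQ hk⟩
  by_cases hacc : Accepts n P Q X Y k
  · rw [h2 k hk hacc]; exact rightOf_lt hP hQ hk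
  · rw [h3 k hk hacc]; omega

/-- The running time of `stabbingProgram`. -/
def runningTime (n : ℕ) : ℕ := 20000 * (n + 1) * (Nat.clog 2 (2 * n) + 1)

theorem runs_stabbingProgram (hn : 0 < n) (hm : m.nat 0 0 = n) (hW : 4 * n + 1 < W) :
    Runs W stabbingProgram m (runningTime n) fun m' =>
      ∃ P Q X Y L, Ranking (2 * n) P X ∧ Ranking (2 * n) Q Y ∧
        SortedPerm (LexLE (m.real 0) (m.real 1)) (2 * n) P ∧
        SortedPerm (LexLE (m.real 1) (m.real 0)) (2 * n) Q ∧ L.Nodup ∧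
        (∀ a b c, (a, b, c) ∈ L ↔ RankStabber (2 * n) P Q X Y a b c ∧
          NoTies (2 * n) P Q (m.real 0) (m.real 1) a b c) ∧
        Written P Q L m' := by
  refine Runs.seq (runs_rankProgram hn hm hW) (U := 14000 * n + 3000) ?_
    (by unfold runningTime; nlinarith [Nat.zero_le (n * Nat.clog 2 (2 * n))])
  rintro m₁ hf₁ ⟨P, Q, X, Y, hl₁, hP, hQ, hsP, hsQ, hz₁⟩
  refine Runs.seq (runs_sweepProgram hl₁ hP hQ hn hW) (U := 8000 * n + 2000) ?_ (by omega)
  intro m₂ hf₂ hs₂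
  change SweepResult n P Q X Y _ _ at hs₂
  have hl₂ := hl₁.frame hf₂ (by decide)
  refine Runs.seq (runs_reflectProgram hl₂ hP hW (fun k hk => (hs₂.bounds hP hQ hk).2.le)
    (fun k hk => (hs₂.bounds hP hQ hk).1)) (U := 7400 * n + 1900) ?_ (by omega)
  rintro m₃ hf₃ ⟨⟨P', X', hl₃, hPr, hP', hX'⟩, hpX, hft, hfr⟩
  have hs₃ : SweepResult n P Q X Y (m₃.nat firstResult) (m₃.nat firstTop) := by
    refine ⟨fun a ha => ?_, fun a ha => ?_, fun a ha => ?_⟩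
    · rw [hft a ha]; exact hs₂.1 a ha
    · rw [hfr a ha]; exact hs₂.2.1 a ha
    · rw [hfr a ha]; exact hs₂.2.2 a ha
  refine Runs.seq (runs_sweepProgram hl₃ hPr hQ hn hW) (U := 1400 * n + 900) ?_ (by omega)
  intro m₄ hf₄ hs₄
  change SweepResult n P' Q X' Y _ _ at hs₄
  have hl₄ := hl₃.frame hf₄ (by decide)
  have hrep : ReportInput (2 * n) P Q (m₃.nat firstResult) (m₃.nat firstTop) (m₄.nat resultArr)
      (m₄.nat topArr) m₄ := by
    refine ⟨hl₄.points, ?_, fun k _ => by rw [hl₄.permY_eq], ?_, ?_, rfl, rfl⟩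
    · rw [hf₄.2 _ (by decide)]; exact hpX
    · exact hf₄.2 _ (by decide)
    · exact hf₄.2 _ (by decide)
  have hr : m₄.real = m.real := by rw [hf₄.1, hf₃.1, hf₂.1, hf₁.1]
  refine (runs_reportProgram hrep hP.lt hQ.lt (by omega) ?_
    (fun k hk => (hs₃.bounds hP hQ hk).1) (fun k hk => (hs₃.bounds hP hQ hk).2)
    (fun k hk => (hs₄.bounds hPr hQ hk).1) (fun k hk => (hs₄.bounds hPr hQ hk).2)).mono
    (by omega) ?_
  · rw [hf₄.2 _ (by decide), hf₃.2 _ (by decide), hf₂.2 _ (by decide), hz₁]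
  · intro m₅ _ hw
    rw [hr] at hw
    exact ⟨P, Q, X, Y, _, hP, hQ, hsP, hsQ, nodup_reported,
      fun a b c => mem_flatMap_reported hs₃ hs₄ hP hQ hPr hP' hX', hw⟩

end

/-! ### Asymptotics and the main theorem. -/

theorem runningTime_isBigO : Asymptotics.IsBigO Filter.atTop (fun n : ℕ => (runningTime n : ℝ))
    (fun n : ℕ => (n : ℝ) * Real.log (n : ℝ)) := by
  -- For `n ≥ 2`, `n + 1 ≤ 2 * n`; moreover `Nat.clog 2 (2 * n) + 1 ≤ Nat.log 2 n + 3 ≤ 8 * Real.log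
  -- n`, since the logarithm is at least 1/2. So the constant is 20000 · 2 · 8.
  refine Asymptotics.IsBigO.of_bound 320000 (Filter.eventually_atTop.2 ⟨2, fun n hn => ?_⟩)
  have hn' : (2 : ℝ) ≤ n := by exact_mod_cast hn
  have hlog2 : (1 / 2 : ℝ) ≤ Real.log 2 := by linarith [Real.log_two_gt_d9]
  have hlog : (1 / 2 : ℝ) ≤ Real.log n := hlog2.trans (Real.log_le_log (by norm_num) hn')
  have hclog : Nat.clog 2 (2 * n) ≤ Nat.log 2 n + 2 := by
    refine Nat.clog_le_of_le_pow ?_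
    have := Nat.lt_pow_succ_log_self (b := 2) (by norm_num) n
    rw [pow_succ]
    omega
  have hnat : (Nat.log 2 n : ℝ) * Real.log 2 ≤ Real.log n := by
    have h : ((2 : ℝ) ^ Nat.log 2 n) ≤ n := by
      exact_mod_cast Nat.pow_log_le_self 2 (by omega)
    rw [← Real.log_pow]
    exact Real.log_le_log (by positivity) h
  have hclog' : (Nat.clog 2 (2 * n) : ℝ) + 1 ≤ 8 * Real.log n := by
    have h1 : (Nat.clog 2 (2 * n) : ℝ) ≤ Nat.log 2 n + 2 := by exact_mod_cast hclog
    have h2 : (Nat.log 2 n : ℝ) * (1 / 2) ≤ Nat.log 2 n * Real.log 2 := by gcongr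
    linarith
  rw [Real.norm_of_nonneg (by positivity), Real.norm_of_nonneg (by positivity), runningTime]
  push_cast
  calc 20000 * ((n : ℝ) + 1) * ((Nat.clog 2 (2 * n) : ℝ) + 1)
      ≤ 20000 * (2 * n) * (8 * Real.log n) := by gcongr; linarith
    _ = 320000 * (n * Real.log n) := by ring

end Stabbing

theorem mainTheorem1 :
    ∃ (prog : RealRAM.Program) (k : ℕ) (T : ℕ → ℕ),
      Asymptotics.IsBigO Filter.atTop (fun n : ℕ => (T n : ℝ))
        (fun n : ℕ => (n : ℝ) * Real.log (n : ℝ)) ∧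
      ∀ n : ℕ, 1 ≤ n → ∀ S : Fin n → Stabbing.Segment,
        ∃ (m : RealRAM.Memory) (t : ℕ) (L : List (Stabbing.Description n)),
          RealRAM.Exec ((n + 1) ^ k) prog (Stabbing.initialMemory S) m t ∧ t ≤ T n ∧
          Stabbing.Outputs m L ∧ Stabbing.ListsAllStabbers S L := by
  refine ⟨Stabbing.stabbingProgram, 3, Stabbing.runningTime, Stabbing.runningTime_isBigO,
    fun n hn S => ?_⟩
  -- The exponent 2 would fail at `n = 1`.
  have hW : 4 * n + 1 < (n + 1) ^ 3 := by
    obtain rfl | h2 := Nat.eq_or_lt_of_le hn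
    · norm_num
    · nlinarith [Nat.zero_le (n ^ 3)]
  obtain ⟨m, t, he, ht, -, P, Q, X, Y, L, hP, hQ, hsP, hsQ, hL, hmem, hw⟩ :=
    Stabbing.runs_stabbingProgram (m := Stabbing.initialMemory S) hn
      (by simp [Stabbing.initialMemory]) hW
  refine ⟨m, t, L.map (Stabbing.describe hn P Q), he, ht, ⟨?_, ?_⟩,
    Stabbing.listsAllStabbers hn S ?_ hsP hP hsQ hQ hL hmem⟩
  · rw [hw.1, List.length_map]
  · intro j hj
    rw [List.length_map] at hj
    obtain ⟨hR, -⟩ := (hmem _ _ _).1 (List.getElem_mem hj)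
    rw [List.getElem_map]
    obtain ⟨h1, h2, h3⟩ := hw.2 j hj
    refine ⟨h1.trans ?_, h2.trans ?_, h3.trans ?_⟩
    · exact (Nat.mod_eq_of_lt (hP.lt _ hR.left_lt)).symm
    · exact (Nat.mod_eq_of_lt (hP.lt _ hR.right_lt)).symm
    · exact (Nat.mod_eq_of_lt (hQ.lt _ hR.top_lt)).symm
  · intro e
    simp [Stabbing.initialMemory]
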